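/- Let $N\ge 2$ and let $\Omega\subset\mathbb{R}^N$ be a nonempty, open, connected, bounded set with $C^2$ boundary and outer unit normal $\nu$. For $x\in\partial\Omega$ let $\kappa_1(x),\dots,\kappa_{N-1}(x)$ be the principal curvatures of $\partial\Omega$ at $x$, i.e. the eigenvalues, with multiplicity, of the differential of $\nu$ on the tangent space (so that they are positive for balls), and set $$\mathcal M=\frac1{N-1}\sum_{i=1}^{N-1}\kappa_i,\qquad \kappa_{\min}=\min_{x\in\partial\Omega}\ \min_{1\le i\le N-1}\kappa_i(x).$$ Let $\beta\in\mathbb{R}\setminus\{0\}$ be such that $-\beta$ is not a Steklov eigenvalue of the Laplacian on $\Omega$, i.e. there is no $v\in C^2(\Omega)\cap C^1(\overline\Omega)$, $v\not\equiv 0$, with $\Delta v=0$ in $\Omega$ and $\frac{\partial v}{\partial\nu}=-\beta v$ on $\partial\Omega$. Let $u\in C^2(\overline\Omega)$ be a solution of $$\begin{cases}\Delta u=N & \text{in }\Omega,\\[2pt] \dfrac{\partial u}{\partial\nu}+\beta u=0 & \text{on }\partial\Omega,\\[4pt] \dfrac{\partial u}{\partial\nu}\,\mathcal M=1 & \text{on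 }\partial\Omega.\end{cases}$$ If $\kappa_{\min}+2\beta>0$, then $\Omega$ is a ball and $u$ is radially symmetric about its centre. -/

import Mathlib

open Set Filter Topology InnerProductSpace

noncomputable section

namespace RobinTorsion

/-- `ρ` is a `C²` defining function of `Ω` near `p`: near `p` the set `Ω` is exactly `{ρ < 0}`, and
the gradient of `ρ` does not vanish at `p`. -/
structure IsDefiningFunctionAt {N : ℕ} (Ω : Set (EuclideanSpace ℝ (Fin N)))
    (p : EuclideanSpace ℝ (Fin N)) (ρ : EuclideanSpace ℝ (Fin N) → ℝ) : Prop where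
  contDiffAt : ContDiffAt ℝ 2 ρ p
  gradient_ne_zero : gradient ρ p ≠ 0
  mem_iff : ∀ᶠ x in 𝓝 p, x ∈ Ω ↔ ρ x < 0

/-- `Ω` has `C²` boundary: near each of its boundary points it lies on one side of a `C²`
hypersurface. -/
def HasC2Boundary {N : ℕ} (Ω : Set (EuclideanSpace ℝ (Fin N))) : Prop :=
  ∀ p ∈ frontier Ω, ∃ ρ, IsDefiningFunctionAt Ω p ρ

open Classical in
/-- The outer unit normal `ν = ∇ρ / |∇ρ|` of `Ω` at `p`, for any defining function `ρ` of `Ω` near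
`p` (it does not depend on `ρ`, see `outerNormal_eq`); zero if there is none. -/
def outerNormal {N : ℕ} (Ω : Set (EuclideanSpace ℝ (Fin N))) (p : EuclideanSpace ℝ (Fin N)) :
    EuclideanSpace ℝ (Fin N) :=
  if h : ∃ ρ, IsDefiningFunctionAt Ω p ρ then
    ‖gradient h.choose p‖⁻¹ • gradient h.choose p
  else 0

/-- The tangent space of `∂Ω` at `p`, as the orthogonal complement of the normal. -/
abbrev tangentSpaceAt {N : ℕ} (Ω : Set (EuclideanSpace ℝ (Fin N)))
    (p : EuclideanSpace ℝ (Fin N)) : Submodule ℝ (EuclideanSpace ℝ (Fin N)) :=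
  (Submodule.span ℝ {outerNormal Ω p})ᗮ

/-- The shape operator of `∂Ω` at `p`: the differential `v ↦ (∇ν) v` of the outer normal field
along `∂Ω`, as an endomorphism of the tangent space. It is positive for strictly convex sets. -/
def shapeOperator {N : ℕ} (Ω : Set (EuclideanSpace ℝ (Fin N))) (p : EuclideanSpace ℝ (Fin N)) :
    tangentSpaceAt Ω p →ₗ[ℝ] tangentSpaceAt Ω p :=
  ((tangentSpaceAt Ω p).orthogonalProjectionOnto ∘L
    fderivWithin ℝ (outerNormal Ω) (frontier Ω) p ∘L (tangentSpaceAt Ω p).subtypeL).toLinearMap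

/-- The principal curvatures `κ₁, …, κ_{N-1}` of `∂Ω` at `p`: the eigenvalues of the shape operator,
repeated according to multiplicity. -/
def principalCurvatures {N : ℕ} (Ω : Set (EuclideanSpace ℝ (Fin N)))
    (p : EuclideanSpace ℝ (Fin N)) : Multiset ℝ :=
  (shapeOperator Ω p).charpoly.roots

/-- The mean curvature `𝓜 = (κ₁ + ⋯ + κ_{N-1}) / (N - 1)` of `∂Ω` at `p`. -/
def meanCurvature {N : ℕ} (Ω : Set (EuclideanSpace ℝ (Fin N)))
    (p : EuclideanSpace ℝ (Fin N)) : ℝ :=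
  (principalCurvatures Ω p).sum / ((N : ℝ) - 1)

/-- The least principal curvature `κ_min` over all boundary points. -/
def minCurvature {N : ℕ} (Ω : Set (EuclideanSpace ℝ (Fin N))) : ℝ :=
  sInf {κ : ℝ | ∃ p ∈ frontier Ω, κ ∈ principalCurvatures Ω p}

/-- The normal derivative `∂u/∂ν` at a boundary point `p`, for `u` of class `C¹` on `closure Ω`. -/
def normalDerivative {N : ℕ} (Ω : Set (EuclideanSpace ℝ (Fin N)))
    (u : EuclideanSpace ℝ (Fin N) → ℝ) (p : EuclideanSpace ℝ (Fin N)) : ℝ :=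
  fderivWithin ℝ u (closure Ω) p (outerNormal Ω p)

/-- `μ` is a Steklov eigenvalue of the Laplacian on `Ω`: there is a nonzero harmonic function `v`
on `Ω`, of class `C¹` up to the boundary, with `∂v/∂ν = μ v` on `∂Ω`. -/
def IsSteklovEigenvalue {N : ℕ} (Ω : Set (EuclideanSpace ℝ (Fin N))) (μ : ℝ) : Prop :=
  ∃ v : EuclideanSpace ℝ (Fin N) → ℝ,
    ContDiffOn ℝ 1 v (closure Ω) ∧ HarmonicOnNhd v Ω ∧
    (∀ p ∈ frontier Ω, normalDerivative Ω v p = μ * v p) ∧ ∃ x ∈ Ω, v x ≠ 0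

/-- `u` is a `C²(closure Ω)` solution of the Robin torsion problem: `Δu = N` in `Ω` and
`∂u/∂ν + β u = 0` on `∂Ω`. -/
structure IsRobinTorsionSolution {N : ℕ} (Ω : Set (EuclideanSpace ℝ (Fin N))) (β : ℝ)
    (u : EuclideanSpace ℝ (Fin N) → ℝ) : Prop where
  contDiffOn : ContDiffOn ℝ 2 u (closure Ω)
  laplacian_eq : ∀ x ∈ Ω, Laplacian.laplacian u x = (N : ℝ)
  robin : ∀ p ∈ frontier Ω, normalDerivative Ω u p + β * u p = 0

theorem IsDefiningFunctionAt.apply_eq_zero {N : ℕ} {Ω : Set (EuclideanSpace ℝ (Fin N))}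
    {p : EuclideanSpace ℝ (Fin N)} {ρ : EuclideanSpace ℝ (Fin N) → ℝ}
    (hρ : IsDefiningFunctionAt Ω p ρ) (hp : p ∈ frontier Ω) : ρ p = 0 := by
  have hc : ContinuousAt ρ p := hρ.contDiffAt.continuousAt
  rcases lt_trichotomy (ρ p) 0 with h | h | h
  · refine absurd ?_ hp.2
    rw [mem_interior_iff_mem_nhds]
    filter_upwards [hρ.mem_iff, hc.eventually_lt_const h] with x hx hx'
    exact hx.2 hx'
  · exact h
  · have hf := mem_closure_iff_frequently.1 hp.1
    obtain ⟨x, hx, h1, h2⟩ :=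
      (hf.and_eventually (hρ.mem_iff.and (hc.eventually_const_lt h))).exists
    exact absurd (h1.1 hx) (not_lt.2 h2.le)

theorem IsDefiningFunctionAt.ray_mem {N : ℕ} {Ω : Set (EuclideanSpace ℝ (Fin N))}
    {p : EuclideanSpace ℝ (Fin N)} {ρ : EuclideanSpace ℝ (Fin N) → ℝ}
    (hρ : IsDefiningFunctionAt Ω p ρ) (hp : p ∈ frontier Ω) (w : EuclideanSpace ℝ (Fin N)) :
    (inner ℝ (gradient ρ p) w < 0 → ∀ᶠ t : ℝ in 𝓝[>] 0, p + t • w ∈ Ω) ∧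
      (0 < inner ℝ (gradient ρ p) w → ∀ᶠ t : ℝ in 𝓝[>] 0, p + t • w ∉ Ω) := by
  have h0 := hρ.apply_eq_zero hp
  have hline : HasDerivAt (fun t : ℝ => p + t • w) w 0 := by
    simpa using ((hasDerivAt_id (0 : ℝ)).smul_const w).const_add p
  have hg := (hρ.contDiffAt.differentiableAt (by norm_num)).hasGradientAt.hasFDerivAt
  have hd : HasDerivAt (fun t : ℝ => ρ (p + t • w)) (inner ℝ (gradient ρ p) w) 0 := by
    have hg' : HasFDerivAt ρ (InnerProductSpace.toDual ℝ _ (gradient ρ p)) (p + (0 : ℝ) • w) := by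
      simpa using hg
    have h := hg'.comp_hasDerivAt (0 : ℝ) hline
    rw [InnerProductSpace.toDual_apply_apply] at h
    exact h
  have hs := (hasDerivAt_iff_tendsto_slope.1 hd).mono_left
    (nhdsWithin_mono 0 (fun t (ht : 0 < t) => ne_of_gt ht) : 𝓝[>] (0 : ℝ) ≤ _)
  have hm : ∀ᶠ t : ℝ in 𝓝[>] 0, p + t • w ∈ Ω ↔ ρ (p + t • w) < 0 := by
    have ht : Tendsto (fun t : ℝ => p + t • w) (𝓝[>] 0) (𝓝 p) := by
      have := hline.continuousAt.tendsto.mono_left (nhdsWithin_le_nhds (s := Ioi (0 : ℝ)))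
      simpa using this
    exact ht.eventually hρ.mem_iff
  constructor
  · intro h
    filter_upwards [hm, hs.eventually_lt_const h, self_mem_nhdsWithin] with t h1 h2 h3
    rw [h1]
    simp only [slope_def_field, zero_smul, add_zero, h0, sub_zero] at h2
    have h3' : (0 : ℝ) < t := h3
    by_contra h4
    exact absurd (div_nonneg (not_lt.1 h4) h3'.le) (not_le.2 h2)
  · intro h
    filter_upwards [hm, hs.eventually_const_lt h, self_mem_nhdsWithin] with t h1 h2 h3
    rw [h1]
    simp only [slope_def_field, zero_smul, add_zero, h0, sub_zero] at h2
    have h3' : (0 : ℝ) < t := h3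
    intro h4
    exact absurd (div_neg_of_neg_of_pos h4 h3') (not_lt.2 h2.le)

/-- The outer normal does not depend on the defining function. -/
theorem outerNormal_eq {N : ℕ} {Ω : Set (EuclideanSpace ℝ (Fin N))}
    {p : EuclideanSpace ℝ (Fin N)} {ρ : EuclideanSpace ℝ (Fin N) → ℝ}
    (hp : p ∈ frontier Ω) (hρ : IsDefiningFunctionAt Ω p ρ) :
    outerNormal Ω p = ‖gradient ρ p‖⁻¹ • gradient ρ p := by
  have h : ∃ ρ, IsDefiningFunctionAt Ω p ρ := ⟨ρ, hρ⟩
  rw [outerNormal, dif_pos h]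
  have hσ := h.choose_spec
  set σ := h.choose
  set a := gradient σ p with ha
  set b := gradient ρ p with hb
  have ha0 : 0 < ‖a‖ := norm_pos_iff.2 hσ.gradient_ne_zero
  have hb0 : 0 < ‖b‖ := norm_pos_iff.2 hρ.gradient_ne_zero
  by_contra hne
  have hlt : inner ℝ (‖a‖⁻¹ • a) (‖b‖⁻¹ • b) < 1 :=
    inner_lt_one_iff_real_of_norm_eq_one (norm_smul_inv_norm (𝕜 := ℝ) hσ.gradient_ne_zero)
      (norm_smul_inv_norm (𝕜 := ℝ) hρ.gradient_ne_zero) |>.2 hne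
  have hlt' : inner ℝ a b < ‖a‖ * ‖b‖ := by
    rw [real_inner_smul_left, real_inner_smul_right, ← mul_assoc, ← mul_inv,
      inv_mul_lt_iff₀ (by positivity)] at hlt
    simpa using hlt
  have h1 : inner ℝ a (‖a‖ • b - ‖b‖ • a) < 0 := by
    rw [inner_sub_right, real_inner_smul_right, real_inner_smul_right,
      real_inner_self_eq_norm_sq]
    nlinarith
  have h2 : 0 < inner ℝ b (‖a‖ • b - ‖b‖ • a) := by
    rw [inner_sub_right, real_inner_smul_right, real_inner_smul_right,
      real_inner_self_eq_norm_sq, real_inner_comm]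
    nlinarith
  obtain ⟨t, ht1, ht2⟩ := (((hσ.ray_mem hp _).1 h1).and ((hρ.ray_mem hp _).2 h2)).exists
  exact ht2 ht1

/-- Vectors orthogonal to the gradient are tangent to the boundary. -/
theorem IsDefiningFunctionAt.mem_tangentConeAt {N : ℕ} {Ω : Set (EuclideanSpace ℝ (Fin N))}
    {p : EuclideanSpace ℝ (Fin N)} {ρ : EuclideanSpace ℝ (Fin N) → ℝ}
    (hρ : IsDefiningFunctionAt Ω p ρ) (hp : p ∈ frontier Ω) {v : EuclideanSpace ℝ (Fin N)}
    (hv : inner ℝ (gradient ρ p) v = 0) : v ∈ tangentConeAt ℝ (frontier Ω) p := by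
  set g := gradient ρ p with hg
  have hg0 : 0 < ‖g‖ := norm_pos_iff.2 hρ.gradient_ne_zero
  have key : ∀ n : ℕ, ∃ t s : ℝ, 0 < t ∧ t < 1 / ((n : ℝ) + 1) ∧ |s| ≤ 1 / ((n : ℝ) + 1) ∧
      p + t • (v + s • g) ∈ frontier Ω := by
    intro n
    have he : (0 : ℝ) < 1 / ((n : ℝ) + 1) := by positivity
    set e : ℝ := 1 / ((n : ℝ) + 1)
    have h1 : inner ℝ g (v + (-e) • g) < 0 := by
      rw [inner_add_right, hv, real_inner_smul_right, real_inner_self_eq_norm_sq]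
      have := mul_pos he (pow_pos hg0 2)
      linarith
    have h2 : 0 < inner ℝ g (v + e • g) := by
      rw [inner_add_right, hv, real_inner_smul_right, real_inner_self_eq_norm_sq]
      have := mul_pos he (pow_pos hg0 2)
      linarith
    have h3 : ∀ᶠ t : ℝ in 𝓝[>] 0, t < e := nhdsWithin_le_nhds (Iio_mem_nhds he)
    obtain ⟨t, ht1, ht2, ht3, ht4⟩ := (((hρ.ray_mem hp _).1 h1).and
      (((hρ.ray_mem hp _).2 h2).and (h3.and self_mem_nhdsWithin))).exists
    have hc : Continuous (fun s : ℝ => p + t • (v + s • g)) := by fun_prop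
    have hpre : IsPreconnected (Icc (-e) e) := isPreconnected_Icc
    by_contra hcon
    push Not at hcon
    have hfr : ∀ s ∈ Icc (-e) e, p + t • (v + s • g) ∉ frontier Ω :=
      fun s hs => hcon t s ht4 ht3 (abs_le.2 hs)
    have hsub : Icc (-e) e ⊆ (fun s : ℝ => p + t • (v + s • g)) ⁻¹' interior Ω ∪
        (fun s : ℝ => p + t • (v + s • g)) ⁻¹' (closure Ω)ᶜ := by
      intro s hs
      by_cases hcl : p + t • (v + s • g) ∈ closure Ω
      · left
        by_contra hi
        exact hfr s hs ⟨hcl, hi⟩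
      · exact Or.inr hcl
    obtain ⟨s, -, hs1, hs2⟩ := hpre _ _ (isOpen_interior.preimage hc)
      (isClosed_closure.isOpen_compl.preimage hc) hsub
      ⟨-e, ⟨le_rfl, by linarith⟩, by
        by_contra hi
        exact hfr (-e) ⟨le_rfl, by linarith⟩ ⟨subset_closure ht1, hi⟩⟩
      ⟨e, ⟨by linarith, le_rfl⟩, by
        intro hcl
        exact hfr e ⟨by linarith, le_rfl⟩ ⟨hcl, fun hi => ht2 (interior_subset hi)⟩⟩
    exact hs2 (subset_closure (interior_subset hs1))
  choose t s ht0 ht1 hs hmem using key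
  have hlim : Tendsto (fun n : ℕ => 1 / ((n : ℝ) + 1)) atTop (𝓝 0) :=
    tendsto_one_div_add_atTop_nhds_zero_nat
  have hs0 : Tendsto s atTop (𝓝 0) := squeeze_zero_norm hs hlim
  have ht : Tendsto t atTop (𝓝 0) :=
    squeeze_zero (fun n => (ht0 n).le) (fun n => (ht1 n).le) hlim
  have hvs : Tendsto (fun n => v + s n • g) atTop (𝓝 v) := by
    simpa using (hs0.smul_const g).const_add v
  refine mem_tangentConeAt_of_seq atTop (fun n => (t n)⁻¹) (fun n => t n • (v + s n • g)) ?_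
    (Eventually.of_forall hmem) ?_
  · simpa using ht.smul hvs
  · refine hvs.congr fun n => ?_
    rw [inv_smul_smul₀ (ht0 n).ne']

/-- The shape operator is the normalised tangential Hessian of any defining function. -/
theorem inner_shapeOperator {N : ℕ} {Ω : Set (EuclideanSpace ℝ (Fin N))}
    {p : EuclideanSpace ℝ (Fin N)} {ρ : EuclideanSpace ℝ (Fin N) → ℝ}
    (hp : p ∈ frontier Ω) (hρ : IsDefiningFunctionAt Ω p ρ) (v w : tangentSpaceAt Ω p) :
    inner ℝ (shapeOperator Ω p v) w =
      ‖gradient ρ p‖⁻¹ * fderiv ℝ (fderiv ℝ ρ) p (v : EuclideanSpace ℝ (Fin N)) w := by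
  have hg0 : ‖gradient ρ p‖ ≠ 0 := norm_ne_zero_iff.2 hρ.gradient_ne_zero
  have hort : ∀ x : tangentSpaceAt Ω p,
      inner ℝ (gradient ρ p) (x : EuclideanSpace ℝ (Fin N)) = 0 := by
    intro x
    have h := Submodule.mem_orthogonal_singleton_iff_inner_right.1 x.2
    rw [outerNormal_eq hp hρ, real_inner_smul_left] at h
    exact (mul_eq_zero.1 h).resolve_left (inv_ne_zero hg0)
  have hD : HasFDerivAt (fderiv ℝ ρ) (fderiv ℝ (fderiv ℝ ρ) p) p :=
    ((hρ.contDiffAt.fderiv_right (m := 1) (by norm_num)).differentiableAt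
      (by norm_num)).hasFDerivAt
  have hG : HasFDerivAt (gradient ρ)
      (((InnerProductSpace.toDual ℝ
        (EuclideanSpace ℝ (Fin N))).symm.toContinuousLinearEquiv.toContinuousLinearMap) ∘L fderiv ℝ (fderiv ℝ ρ) p) p :=
    ((InnerProductSpace.toDual ℝ
      (EuclideanSpace ℝ (Fin N))).symm.toContinuousLinearEquiv.hasFDerivAt).comp p hD
  have hn : DifferentiableAt ℝ (fun x => ‖gradient ρ x‖⁻¹) p :=
    (hG.differentiableAt.norm ℝ hρ.gradient_ne_zero).inv hg0
  have hν := hn.hasFDerivAt.smul hG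
  have hev : outerNormal Ω =ᶠ[𝓝[frontier Ω] p]
      (fun x => ‖gradient ρ x‖⁻¹ • gradient ρ x) := by
    have h2 : ∀ᶠ x in 𝓝 p, ContDiffAt ℝ 2 ρ x := hρ.contDiffAt.eventually (by simp)
    have h3 : ∀ᶠ x in 𝓝 p, gradient ρ x ≠ 0 :=
      hG.continuousAt.eventually_ne hρ.gradient_ne_zero
    have h4 := hρ.mem_iff.eventually_nhds
    filter_upwards [nhdsWithin_le_nhds h2, nhdsWithin_le_nhds h3, nhdsWithin_le_nhds h4,
      self_mem_nhdsWithin] with x hx2 hx3 hx4 hx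
    exact outerNormal_eq hx ⟨hx2, hx3, hx4⟩
  have hν' := (hν.hasFDerivWithinAt (s := frontier Ω)).congr_of_eventuallyEq hev
    (outerNormal_eq hp hρ)
  have heq := hν'.differentiableWithinAt.hasFDerivWithinAt.unique_on hν'
    (hρ.mem_tangentConeAt hp (hort v))
  have hproj : inner ℝ (shapeOperator Ω p v) w =
      inner ℝ (fderivWithin ℝ (outerNormal Ω) (frontier Ω) p v)
        (w : EuclideanSpace ℝ (Fin N)) := by
    exact Submodule.inner_orthogonalProjectionOnto_eq_of_mem_right w _
  rw [hproj, heq]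
  simp [inner_add_left, real_inner_smul_left, hort w]

end RobinTorsion

end

/-! The engine is a Reilly-type identity. Reilly's formula for `u`, with `Δu = N`, the Robin
condition and `u_ν 𝓜 = 1` inserted, reads formally `∫_Ω |D²u - I|² + ∫_∂Ω (II(τ, τ) + 2β |τ|²) = 0`,
where `τ` is the tangential part of `∇u` and `II` is the second fundamental form. Since `II(τ, τ) ≥
κ_min |τ|²` and `κ_min + 2β > 0`, both terms are nonnegative, so `D²u = I` in `Ω`
(`fderiv_gradient_eq_id`), and connectedness gives `u = |x - z|²/2 + c` (`exists_eq_paraboloid`).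

No surface integral is taken. A global defining function `ρ` supplies cutoffs `φ` with `∇φ = -m ∇ρ`,
where `m` lives in a thin layer and plays the role of surface measure. Because `∇u` is only `C¹`,
the identity `∫ φ tr((D²u)²) = -∫ ⟨∇φ, (D²u)∇u⟩ + c ∫ ⟨…⟩`-type arguments avoid third derivatives:
mixed partials are commuted weakly (`integral_fderiv_mul_fderiv_comm`). The divergence theorem on
the closed surface `∂Ω` is replaced by a field `X` orthogonal to `∇ρ`, for which `∫ m div X = 0`.
The limit argument is `trace_sq_eq_of_boundary_nonneg`; its boundary sign is
`boundary_integrand_nonneg`.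

It remains to see that `∂Ω` is a sphere around `z` (`exists_frontier_subset_sphere`). For `β > 0`
the boundary point farthest from `z` is compared with the others. For `β < 0` the curvature bound
forces `x - z` to be normal, so `|x - z|` solves a quadratic equation of which only one root is
admissible. -/

noncomputable section

namespace RobinTorsion

/-! ### Divergence as the trace of the derivative -/

section Divergence

variable {E : Type*} [NormedAddCommGroup E] [InnerProductSpace ℝ E]

/-- The divergence of a vector field. -/
def divergence (F : E → E) (x : E) : ℝ := LinearMap.trace ℝ E (fderiv ℝ F x).toLinearMap

theorem contDiff_smul_of_tsupport_subset {F : Type*} [NormedAddCommGroup F] [NormedSpace ℝ F]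
    {n : WithTop ℕ∞} {φ : E → ℝ} {V : E → F} {U : Set E}
    (hφ : ContDiff ℝ n φ) (hU : IsOpen U) (hsub : tsupport φ ⊆ U) (hV : ContDiffOn ℝ n V U) :
    ContDiff ℝ n fun x => φ x • V x := by
  rw [contDiff_iff_contDiffAt]
  intro x
  by_cases hx : x ∈ tsupport φ
  · exact hφ.contDiffAt.smul (hV.contDiffAt (hU.mem_nhds (hsub hx)))
  · refine (contDiffAt_const (c := (0 : F))).congr_of_eventuallyEq ?_
    filter_upwards [notMem_tsupport_iff_eventuallyEq.1 hx] with y hy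
    simp [hy]

theorem divergence_sub {V W : E → E} {x : E} (hV : DifferentiableAt ℝ V x)
    (hW : DifferentiableAt ℝ W x) :
    divergence (fun y => V y - W y) x = divergence V x - divergence W x := by
  rw [divergence, fderiv_fun_sub hV hW]
  exact map_sub (LinearMap.trace ℝ E) _ _

theorem continuous_trace_toLinearMap [FiniteDimensional ℝ E] :
    Continuous fun L : E →L[ℝ] E => LinearMap.trace ℝ E L.toLinearMap :=
  LinearMap.continuous_of_finiteDimensional
    ((LinearMap.trace ℝ E).comp (ContinuousLinearMap.coeLM ℝ))

end Divergence

/-! ### Integration by parts for compactly supported `C¹` fields -/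

section IntegrationByParts

open MeasureTheory

variable {E : Type*} [NormedAddCommGroup E] [InnerProductSpace ℝ E] [FiniteDimensional ℝ E]
  [MeasurableSpace E] [BorelSpace E]

theorem integral_fderiv_apply_eq_zero {μ : Measure E} [μ.IsAddHaarMeasure] {f : E → ℝ}
    (hf : ContDiff ℝ 1 f) (hfs : HasCompactSupport f) (v : E) :
    ∫ x, fderiv ℝ f x v ∂μ = 0 := by
  have hc : Continuous fun x => fderiv ℝ f x v :=
    (hf.continuous_fderiv (by norm_num)).clm_apply continuous_const
  have h := integral_mul_fderiv_eq_neg_fderiv_mul_of_integrable (μ := μ) (f := fun _ => (1 : ℝ))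
    (g := f) (v := v) (by simp)
    (by simpa using hc.integrable_of_hasCompactSupport (hfs.fderiv_apply ℝ v))
    (by simpa using hf.continuous.integrable_of_hasCompactSupport hfs)
    (fun x _ => by fun_prop) (fun x _ => hf.differentiable (by norm_num) x)
  simpa using h

/-- Weak commutation of partial derivatives of `C¹` functions. -/
theorem integral_fderiv_mul_fderiv_comm {μ : Measure E} [μ.IsAddHaarMeasure] {f g : E → ℝ}
    (hf : ContDiff ℝ 1 f) (hfs : HasCompactSupport f) (hg : ContDiff ℝ 1 g)
    (hgs : HasCompactSupport g) (a b : E) :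
    ∫ x, fderiv ℝ f x a * fderiv ℝ g x b ∂μ = ∫ x, fderiv ℝ f x b * fderiv ℝ g x a ∂μ := by
  have hf1 : Differentiable ℝ f := hf.differentiable (by norm_num)
  have hg1 : Differentiable ℝ g := hg.differentiable (by norm_num)
  have hfc : ∀ v, Continuous fun x => fderiv ℝ f x v := fun v =>
    (hf.continuous_fderiv (by norm_num)).clm_apply continuous_const
  have hgc : ∀ v, Continuous fun x => fderiv ℝ g x v := fun v =>
    (hg.continuous_fderiv (by norm_num)).clm_apply continuous_const
  obtain ⟨Cf, hCf⟩ := hf.lipschitzWith_of_hasCompactSupport hfs (by norm_num)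
  obtain ⟨Cg, hCg⟩ := hg.lipschitzWith_of_hasCompactSupport hgs (by norm_num)
  have hA := hCf.integral_inv_smul_sub_mul_tendsto_integral_lineDeriv_mul' (μ := μ) hfs (hgc b) a
  have hB := hCg.integral_inv_smul_sub_mul_tendsto_integral_lineDeriv_mul' (μ := μ) hgs (hfc b) (-a)
  -- The difference quotient in direction `a` passes from `f` to `g` by translation invariance, and
  -- `∂_b` by integration by parts. No second derivative appears, and `t → 0` gives the claim.
  have key : ∀ t : ℝ, ∫ x, (t⁻¹ • (f (x + t • a) - f x)) * fderiv ℝ g x b ∂μ =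
      -∫ x, (t⁻¹ • (g (x + t • (-a)) - g x)) * fderiv ℝ f x b ∂μ := by
    intro t
    have hsh : ContDiff ℝ 1 fun x => f (x + t • a) := hf.comp (contDiff_id.add contDiff_const)
    have hd : ∀ x, fderiv ℝ (fun x => f (x + t • a)) x = fderiv ℝ f (x + t • a) :=
      fun x => fderiv_comp_add_right (t • a)
    have hibp : ∀ k : E → ℝ, ContDiff ℝ 1 k →
        ∫ x, k x * fderiv ℝ g x b ∂μ = -∫ x, fderiv ℝ k x b * g x ∂μ := by
      intro k hk
      have hkc : Continuous fun x => fderiv ℝ k x b :=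
        (hk.continuous_fderiv (by norm_num)).clm_apply continuous_const
      exact integral_mul_fderiv_eq_neg_fderiv_mul_of_integrable
        ((hkc.mul hg.continuous).integrable_of_hasCompactSupport hgs.mul_left)
        ((hk.continuous.mul (hgc b)).integrable_of_hasCompactSupport
          (hgs.fderiv_apply ℝ b).mul_left)
        ((hk.continuous.mul hg.continuous).integrable_of_hasCompactSupport hgs.mul_left)
        (fun x _ => hk.differentiable (by norm_num) x) (fun x _ => hg1 x)
    have htr : ∫ x, fderiv ℝ f (x + t • a) b * g x ∂μ =
        ∫ x, fderiv ℝ f x b * g (x + t • (-a)) ∂μ := by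
      rw [← integral_add_right_eq_self _ (t • (-a))]; simp
    have i1 : Integrable (fun x => f (x + t • a) * fderiv ℝ g x b) μ :=
      (hsh.continuous.mul (hgc b)).integrable_of_hasCompactSupport (hgs.fderiv_apply ℝ b).mul_left
    have i2 : Integrable (fun x => f x * fderiv ℝ g x b) μ :=
      (hf.continuous.mul (hgc b)).integrable_of_hasCompactSupport (hgs.fderiv_apply ℝ b).mul_left
    have i3 : Integrable (fun x => fderiv ℝ f x b * g (x + t • (-a))) μ :=
      ((hfc b).mul (hg.continuous.comp (continuous_add_const _))).integrable_of_hasCompactSupport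
        (hfs.fderiv_apply ℝ b).mul_right
    have i4 : Integrable (fun x => fderiv ℝ f x b * g x) μ :=
      ((hfc b).mul hg.continuous).integrable_of_hasCompactSupport (hfs.fderiv_apply ℝ b).mul_right
    have e1 := hibp _ hsh
    have e2 := hibp _ hf
    simp only [hd] at e1
    rw [htr] at e1
    calc ∫ x, (t⁻¹ • (f (x + t • a) - f x)) * fderiv ℝ g x b ∂μ
        = t⁻¹ * ∫ x, (f (x + t • a) * fderiv ℝ g x b - f x * fderiv ℝ g x b) ∂μ := by
          rw [← integral_const_mul]; congr 1; ext x; simp only [smul_eq_mul]; ring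
      _ = t⁻¹ * -∫ x, (fderiv ℝ f x b * g (x + t • (-a)) - fderiv ℝ f x b * g x) ∂μ := by
          rw [integral_sub i1 i2, integral_sub i3 i4, e1, e2]; ring
      _ = _ := by
          rw [mul_neg, ← integral_const_mul]; congr 2; ext x; simp only [smul_eq_mul]; ring
  have hlim := tendsto_nhds_unique (hA.congr key) hB.neg
  simp only [fun x v => (hf1 x).lineDeriv_eq_fderiv (v := v),
    fun x v => (hg1 x).lineDeriv_eq_fderiv (v := v), map_neg, neg_mul, integral_neg, neg_neg] at hlim
  rw [hlim]
  congr 1; ext x; ring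

theorem integral_divergence_eq_zero {μ : Measure E} [μ.IsAddHaarMeasure] {F : E → E}
    (hF : ContDiff ℝ 1 F) (hFs : HasCompactSupport F) : ∫ x, divergence F x ∂μ = 0 := by
  set e := stdOrthonormalBasis ℝ E
  have hd : Differentiable ℝ F := hF.differentiable (by norm_num)
  have hC : ∀ i, ContDiff ℝ 1 fun x => inner ℝ (e i) (F x) := fun i => contDiff_const.inner ℝ hF
  have hS : ∀ i, HasCompactSupport fun x => inner ℝ (e i) (F x) := fun i =>
    hFs.comp_left (g := fun y => inner ℝ (e i) y) (by simp)
  have hD : ∀ i x v, fderiv ℝ (fun x => inner ℝ (e i) (F x)) x v =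
      inner ℝ (e i) (fderiv ℝ F x v) := by
    intro i x v
    rw [fderiv_inner_apply ℝ (by fun_prop) (hd x)]; simp
  have h : ∀ x, divergence F x = ∑ i, fderiv ℝ (fun x => inner ℝ (e i) (F x)) x (e i) := by
    intro x
    rw [divergence, LinearMap.trace_eq_sum_inner _ e]
    simp [hD]
  simp only [h]
  rw [integral_finsetSum]
  · exact Finset.sum_eq_zero fun i _ => integral_fderiv_apply_eq_zero (hC i) (hS i) _
  · intro i _
    exact (((hC i).continuous_fderiv (by norm_num)).clm_apply
      continuous_const).integrable_of_hasCompactSupport ((hS i).fderiv_apply ℝ _)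

/-- In an orthonormal basis the two integrands are `∑ ∂_j W_i ∂_i V_j` and `∑ ∂_i W_i ∂_j V_j`; weak
commutation of partial derivatives matches them term by term. -/
theorem integral_trace_comp_eq {μ : Measure E} [μ.IsAddHaarMeasure] {W V : E → E}
    (hW : ContDiff ℝ 1 W) (hWs : HasCompactSupport W) (hV : ContDiff ℝ 1 V)
    (hVs : HasCompactSupport V) :
    ∫ x, LinearMap.trace ℝ E (fderiv ℝ W x ∘L fderiv ℝ V x).toLinearMap ∂μ =
      ∫ x, divergence W x * divergence V x ∂μ := by
  set e := stdOrthonormalBasis ℝ E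
  have hC : ∀ {F : E → E}, ContDiff ℝ 1 F → ∀ i, ContDiff ℝ 1 fun x => inner ℝ (e i) (F x) :=
    fun hF i => contDiff_const.inner ℝ hF
  have hS : ∀ {F : E → E}, HasCompactSupport F → ∀ i,
      HasCompactSupport fun x => inner ℝ (e i) (F x) := fun hFs i =>
    hFs.comp_left (g := fun y => inner ℝ (e i) y) (by simp)
  have hD : ∀ {F : E → E}, ContDiff ℝ 1 F → ∀ i x v, fderiv ℝ (fun x => inner ℝ (e i) (F x)) x v =
      inner ℝ (e i) (fderiv ℝ F x v) := by
    intro F hF i x v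
    rw [fderiv_inner_apply ℝ (by fun_prop) (hF.differentiable (by norm_num) x)]; simp
  have h1 : ∀ x, LinearMap.trace ℝ E (fderiv ℝ W x ∘L fderiv ℝ V x).toLinearMap =
      ∑ i, ∑ j, fderiv ℝ (fun x => inner ℝ (e i) (W x)) x (e j) *
        fderiv ℝ (fun x => inner ℝ (e j) (V x)) x (e i) := by
    intro x
    rw [LinearMap.trace_eq_sum_inner _ e]
    refine Finset.sum_congr rfl fun i _ => ?_
    simp only [hD hW, hD hV, ContinuousLinearMap.coe_coe, ContinuousLinearMap.comp_apply]
    conv_lhs => rw [← e.sum_repr' (fderiv ℝ V x (e i))]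
    simp [inner_sum, real_inner_smul_right, mul_comm]
  have h2 : ∀ x, divergence W x * divergence V x =
      ∑ i, ∑ j, fderiv ℝ (fun x => inner ℝ (e i) (W x)) x (e i) *
        fderiv ℝ (fun x => inner ℝ (e j) (V x)) x (e j) := by
    intro x
    rw [divergence, divergence, LinearMap.trace_eq_sum_inner _ e, LinearMap.trace_eq_sum_inner _ e,
      Finset.sum_mul_sum]
    simp [hD hW, hD hV]
  have hint : ∀ i j (a b : E), Integrable (fun x =>
      fderiv ℝ (fun x => inner ℝ (e i) (W x)) x a *
        fderiv ℝ (fun x => inner ℝ (e j) (V x)) x b) μ := by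
    intro i j a b
    exact ((((hC hW i).continuous_fderiv (by norm_num)).clm_apply continuous_const).mul
      (((hC hV j).continuous_fderiv (by norm_num)).clm_apply
        continuous_const)).integrable_of_hasCompactSupport ((hS hWs i).fderiv_apply ℝ a).mul_right
  simp only [h1, h2]
  rw [integral_finsetSum _ fun i _ => integrable_finsetSum _ fun j _ => hint i j _ _,
    integral_finsetSum _ fun i _ => integrable_finsetSum _ fun j _ => hint i j _ _]
  refine Finset.sum_congr rfl fun i _ => ?_
  rw [integral_finsetSum _ fun j _ => hint i j _ _, integral_finsetSum _ fun j _ => hint i j _ _]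
  exact Finset.sum_congr rfl fun j _ =>
    integral_fderiv_mul_fderiv_comm (hC hW i) (hS hWs i) (hC hV j) (hS hVs j) _ _

end IntegrationByParts

/-! ### Weak divergence identities for fields defined on an open set -/

section WeakIdentities

variable {E : Type*} [NormedAddCommGroup E] [InnerProductSpace ℝ E] [FiniteDimensional ℝ E]

theorem exists_contDiff_cutoff {K U : Set E} (hK : IsCompact K) (hU : IsOpen U) (hKU : K ⊆ U) :
    ∃ ψ : E → ℝ, ContDiff ℝ 1 ψ ∧ HasCompactSupport ψ ∧ tsupport ψ ⊆ U ∧ ∀ x ∈ K, ψ =ᶠ[𝓝 x] 1 := by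
  obtain ⟨L, hL, hKL, hLU⟩ := exists_compact_between hK hU hKU
  obtain ⟨f, h1, h0, -⟩ := exists_contMDiffMap_one_nhds_of_subset_interior (n := 1)
    (modelWithCornersSelf ℝ E) hK.isClosed hKL
  have hts : tsupport (f : E → ℝ) ⊆ L := by
    refine closure_minimal (fun x hx => ?_) hL.isClosed
    by_contra hxL
    exact hx (h0 x hxL)
  refine ⟨f, f.contMDiff.contDiff, hL.of_isClosed_subset (isClosed_tsupport _) hts,
    hts.trans hLU, fun x hx => ?_⟩
  exact eventually_nhdsSet_iff_forall.1 h1 x hx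

theorem divergence_smul {φ : E → ℝ} {V : E → E} {x : E} (hφ : DifferentiableAt ℝ φ x)
    (hV : DifferentiableAt ℝ V x) :
    divergence (fun y => φ y • V y) x = φ x * divergence V x + fderiv ℝ φ x (V x) := by
  rw [divergence, fderiv_fun_smul hφ hV]
  have : (φ x • fderiv ℝ V x + (fderiv ℝ φ x).smulRight (V x)).toLinearMap =
      φ x • (fderiv ℝ V x).toLinearMap + (fderiv ℝ φ x).toLinearMap.smulRight (V x) := rfl
  rw [this, map_add, map_smul, LinearMap.trace_smulRight]
  rfl

variable [MeasurableSpace E] [BorelSpace E]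

open MeasureTheory

theorem integral_divergence_smul_eq_zero {μ : Measure E} [μ.IsAddHaarMeasure] {φ : E → ℝ}
    {V : E → E} {U : Set E} (hφ : ContDiff ℝ 1 φ) (hφs : HasCompactSupport φ) (hU : IsOpen U)
    (hsub : tsupport φ ⊆ U) (hV : ContDiffOn ℝ 1 V U) :
    ∫ x, (φ x * divergence V x + fderiv ℝ φ x (V x)) ∂μ = 0 := by
  rw [← integral_divergence_eq_zero (μ := μ) (contDiff_smul_of_tsupport_subset hφ hU hsub hV)
    hφs.smul_right]
  congr 1; ext x
  by_cases hx : x ∈ U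
  · exact (divergence_smul (hφ.differentiable (by norm_num) x)
      ((hV.contDiffAt (hU.mem_nhds hx)).differentiableAt (by norm_num))).symm
  · have hx' : x ∉ tsupport φ := fun h => hx (hsub h)
    have h0 : divergence (fun y => φ y • V y) x = 0 := by
      rw [divergence,
        fderiv_of_notMem_tsupport ℝ fun h => hx' (tsupport_smul_subset_left φ V h)]
      simp
    rw [fderiv_of_notMem_tsupport ℝ hx', image_eq_zero_of_notMem_tsupport hx', h0]
    simp

/-- Replacing `V` by `ψ V`, with `ψ = 1` near the support of `W`, makes `integral_trace_comp_eq`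
applicable without changing the integrand. The right side becomes `c ∫ div W`, which vanishes. -/
theorem integral_trace_comp_eq_zero {μ : Measure E} [μ.IsAddHaarMeasure] {W V : E → E} {U : Set E}
    {c : ℝ} (hW : ContDiff ℝ 1 W) (hWs : HasCompactSupport W) (hU : IsOpen U)
    (hsub : tsupport W ⊆ U) (hV : ContDiffOn ℝ 1 V U) (hdiv : ∀ x ∈ U, divergence V x = c) :
    ∫ x, LinearMap.trace ℝ E (fderiv ℝ W x ∘L fderiv ℝ V x).toLinearMap ∂μ = 0 := by
  obtain ⟨ψ, hψ, hψs, hψU, hψ1⟩ := exists_contDiff_cutoff hWs hU hsub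
  have hV' := contDiff_smul_of_tsupport_subset hψ hU hψU hV
  have heq : ∀ x ∈ tsupport W, fderiv ℝ (fun y => ψ y • V y) x = fderiv ℝ V x := by
    intro x hx
    refine Filter.EventuallyEq.fderiv_eq ?_
    filter_upwards [hψ1 x hx] with y hy
    simp [hy]
  have h := integral_trace_comp_eq (μ := μ) hW hWs hV' hψs.smul_right
  have h1 : ∀ x, fderiv ℝ W x ∘L fderiv ℝ (fun y => ψ y • V y) x =
      fderiv ℝ W x ∘L fderiv ℝ V x := by
    intro x
    by_cases hx : x ∈ tsupport W
    · rw [heq x hx]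
    · rw [fderiv_of_notMem_tsupport ℝ hx]; simp
  have h2 : ∀ x, divergence W x * divergence (fun y => ψ y • V y) x = c * divergence W x := by
    intro x
    by_cases hx : x ∈ tsupport W
    · rw [← hdiv x (hsub hx), divergence, divergence, divergence, heq x hx, mul_comm]
    · simp [divergence, fderiv_of_notMem_tsupport ℝ hx]
  simp only [h1, h2, integral_const_mul, integral_divergence_eq_zero hW hWs, mul_zero] at h
  exact h

/-- For a field `V` of constant divergence, `∫ φ tr((DV)²) = -∫ ⟨∇φ, (DV) V⟩`. -/
theorem integral_mul_trace_sq_add_eq_zero {μ : Measure E} [μ.IsAddHaarMeasure] {φ : E → ℝ}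
    {V : E → E} {U : Set E} {c : ℝ} (hφ : ContDiff ℝ 1 φ) (hφs : HasCompactSupport φ)
    (hU : IsOpen U) (hsub : tsupport φ ⊆ U) (hV : ContDiffOn ℝ 1 V U)
    (hdiv : ∀ x ∈ U, divergence V x = c) :
    ∫ x, (φ x * LinearMap.trace ℝ E (fderiv ℝ V x ∘L fderiv ℝ V x).toLinearMap +
      fderiv ℝ φ x (fderiv ℝ V x (V x))) ∂μ = 0 := by
  have hts : tsupport (fun x => φ x • V x) ⊆ tsupport φ := tsupport_smul_subset_left φ V
  -- The test field is `W = φ V`, so that `DW = φ DV + V ⊗ ∇φ`.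
  rw [← integral_trace_comp_eq_zero (μ := μ) (contDiff_smul_of_tsupport_subset hφ hU hsub hV)
    hφs.smul_right hU (hts.trans hsub) hV hdiv]
  congr 1; ext x
  by_cases hx : x ∈ U
  · rw [fderiv_fun_smul (hφ.differentiable (by norm_num) x)
      ((hV.contDiffAt (hU.mem_nhds hx)).differentiableAt (by norm_num))]
    have : ((φ x • fderiv ℝ V x + (fderiv ℝ φ x).smulRight (V x)) ∘L fderiv ℝ V x).toLinearMap =
      φ x • (fderiv ℝ V x ∘L fderiv ℝ V x).toLinearMap +
        ((fderiv ℝ φ x) ∘L fderiv ℝ V x).toLinearMap.smulRight (V x) := rfl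
    rw [this, map_add, map_smul, LinearMap.trace_smulRight]
    rfl
  · have hx' : x ∉ tsupport φ := fun h => hx (hsub h)
    rw [fderiv_of_notMem_tsupport ℝ hx', image_eq_zero_of_notMem_tsupport hx',
      fderiv_of_notMem_tsupport ℝ fun h => hx' (hts h)]
    simp

end WeakIdentities

/-! ### Boundary layers and the limit at the boundary -/

section Layer

section LayerValues

variable {E : Type*}

/-- A smooth cutoff which vanishes on `{-ε ≤ ρ}` and equals one on `{ρ ≤ -2ε}`. -/
def layerCutoff (ρ : E → ℝ) (ε : ℝ) (x : E) : ℝ := Real.smoothTransition (-ρ x / ε - 1)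

/-- The factor `m` in `∇(layerCutoff ρ ε) = -m ∇ρ`, supported in `{-2ε ≤ ρ ≤ -ε}`. -/
def layerDensity (ρ : E → ℝ) (ε : ℝ) (x : E) : ℝ :=
  ε⁻¹ * deriv Real.smoothTransition (-ρ x / ε - 1)

variable {ρ : E → ℝ} {ε : ℝ}

theorem layerDensity_nonneg (hε : 0 < ε) (x : E) : 0 ≤ layerDensity ρ ε x :=
  mul_nonneg (inv_nonneg.2 hε.le) Real.smoothTransition.monotone.deriv_nonneg

theorem layerCutoff_nonneg (x : E) : 0 ≤ layerCutoff ρ ε x := Real.smoothTransition.nonneg _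

theorem layerCutoff_le_one (x : E) : layerCutoff ρ ε x ≤ 1 := Real.smoothTransition.le_one _

theorem layerCutoff_anti {ε' : ℝ} (hε : 0 < ε) (hε' : ε ≤ ε') {x : E} (hx : ρ x ≤ 0) :
    layerCutoff ρ ε' x ≤ layerCutoff ρ ε x := by
  refine Real.smoothTransition.monotone (sub_le_sub_right ?_ 1)
  exact div_le_div_of_nonneg_left (neg_nonneg.2 hx) hε hε'

theorem layerCutoff_eq_zero (hε : 0 < ε) {x : E} (hx : -ε ≤ ρ x) : layerCutoff ρ ε x = 0 := by
  refine Real.smoothTransition.zero_of_nonpos ?_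
  rw [sub_nonpos, div_le_one hε]; linarith

theorem layerCutoff_eq_one (hε : 0 < ε) {x : E} (hx : ρ x ≤ -(2 * ε)) :
    layerCutoff ρ ε x = 1 := by
  refine Real.smoothTransition.one_of_one_le ?_
  rw [le_sub_iff_add_le, le_div_iff₀ hε]; linarith

theorem layerDensity_ne_zero (hε : 0 < ε) {x : E} (hx : layerDensity ρ ε x ≠ 0) :
    -(2 * ε) ≤ ρ x ∧ ρ x ≤ -ε := by
  constructor
  · by_contra! h
    apply hx
    have h1 : 1 < -ρ x / ε - 1 := by rw [lt_sub_iff_add_lt, lt_div_iff₀ hε]; linarith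
    have : Real.smoothTransition =ᶠ[𝓝 (-ρ x / ε - 1)] fun _ => 1 := by
      filter_upwards [lt_mem_nhds h1] with t ht
      exact Real.smoothTransition.one_of_one_le ht.le
    rw [layerDensity, this.deriv_eq]; simp
  · by_contra! h
    apply hx
    have h1 : -ρ x / ε - 1 < 0 := by rw [sub_neg, div_lt_one hε]; linarith
    have : Real.smoothTransition =ᶠ[𝓝 (-ρ x / ε - 1)] fun _ => 0 := by
      filter_upwards [gt_mem_nhds h1] with t ht
      exact Real.smoothTransition.zero_of_nonpos ht.le
    rw [layerDensity, this.deriv_eq]; simp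

theorem continuous_mul_of_tsupport_subset [TopologicalSpace E] {φ f : E → ℝ} {U : Set E} (hφ : Continuous φ)
    (hU : IsOpen U) (hsub : tsupport φ ⊆ U) (hf : ContinuousOn f U) :
    Continuous fun x => φ x * f x := by
  rw [continuous_iff_continuousAt]
  intro x
  by_cases hx : x ∈ tsupport φ
  · exact hφ.continuousAt.mul (hf.continuousAt (hU.mem_nhds (hsub hx)))
  · refine (continuousAt_const (y := (0 : ℝ))).congr ?_
    filter_upwards [notMem_tsupport_iff_eventuallyEq.1 hx] with y hy
    simp [hy]

theorem tsupport_layerCutoff_subset [TopologicalSpace E] (hρ : Continuous ρ) (hε : 0 < ε) :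
    tsupport (layerCutoff ρ ε) ⊆ {x | ρ x ≤ -ε} := by
  refine closure_minimal (fun x hx => ?_) (isClosed_le hρ continuous_const)
  by_contra h
  exact hx (layerCutoff_eq_zero hε (not_le.1 h).le)

theorem tsupport_layerDensity_subset [TopologicalSpace E] (hρ : Continuous ρ) (hε : 0 < ε) :
    tsupport (layerDensity ρ ε) ⊆ {x | -(2 * ε) ≤ ρ x ∧ ρ x ≤ -ε} :=
  closure_minimal (fun _ hx => layerDensity_ne_zero hε hx)
    ((isClosed_le continuous_const hρ).inter (isClosed_le hρ continuous_const))

end LayerValues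

variable {E : Type*} [NormedAddCommGroup E] [InnerProductSpace ℝ E]

variable {ρ : E → ℝ} {ε : ℝ}

theorem contDiff_layerCutoff (hρ : ContDiff ℝ 1 ρ) : ContDiff ℝ 1 (layerCutoff ρ ε) :=
  (Real.smoothTransition.contDiff (n := 1)).comp ((hρ.neg.div_const ε).sub contDiff_const)

theorem contDiff_deriv_smoothTransition : ContDiff ℝ 1 (deriv Real.smoothTransition) := by
  have h : ContDiff ℝ (1 + 1) Real.smoothTransition := Real.smoothTransition.contDiff (n := 2)
  exact (contDiff_succ_iff_deriv.1 h).2.2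

theorem contDiff_layerDensity (hρ : ContDiff ℝ 1 ρ) : ContDiff ℝ 1 (layerDensity ρ ε) :=
  contDiff_const.mul
    (contDiff_deriv_smoothTransition.comp ((hρ.neg.div_const ε).sub contDiff_const))

theorem hasFDerivAt_layerArgument (hρ : ContDiff ℝ 1 ρ) (x : E) :
    HasFDerivAt (fun y => -ρ y / ε - 1) ((-ε⁻¹) • fderiv ℝ ρ x) x := by
  have h := (((hρ.differentiable (by norm_num) x).hasFDerivAt).const_mul (-ε⁻¹)).sub_const 1
  refine h.congr_of_eventuallyEq (Eventually.of_forall fun y => ?_)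
  simp only [div_eq_mul_inv]; ring

theorem fderiv_layerCutoff (hρ : ContDiff ℝ 1 ρ) (x : E) :
    fderiv ℝ (layerCutoff ρ ε) x = -layerDensity ρ ε x • fderiv ℝ ρ x := by
  have h := ((Real.smoothTransition.contDiff (n := 1)).differentiable
    (by norm_num) (-ρ x / ε - 1)).hasDerivAt.comp_hasFDerivAt x
      (hasFDerivAt_layerArgument (ε := ε) hρ x)
  refine h.fderiv.trans ?_
  rw [smul_smul, layerDensity]
  congr 1; ring

/-- The density is a function of `ρ` alone, so its derivative vanishes on every field tangent to the
level sets of `ρ`. This is what gives `∫ m div X = 0`. -/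
theorem exists_fderiv_layerDensity (hρ : ContDiff ℝ 1 ρ) (x : E) :
    ∃ s : ℝ, fderiv ℝ (layerDensity ρ ε) x = s • fderiv ℝ ρ x := by
  have h := ((contDiff_deriv_smoothTransition.differentiable
    (by norm_num) (-ρ x / ε - 1)).hasDerivAt.comp_hasFDerivAt x
      (hasFDerivAt_layerArgument (ε := ε) hρ x)).const_mul ε⁻¹
  exact ⟨ε⁻¹ * deriv (deriv Real.smoothTransition) (-ρ x / ε - 1) * -ε⁻¹,
    h.fderiv.trans (by rw [smul_smul, smul_smul])⟩

variable [FiniteDimensional ℝ E] [MeasurableSpace E] [BorelSpace E]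

open MeasureTheory

/-- A bounded domain `{ρ < 0}`, a field `P` of constant divergence `c` with
`tr((DP)²) ≥ c`, and a field `X` tangent to the level sets of `ρ` near the boundary. If
`⟨∇ρ, P - (DP) P⟩ + div X` is asymptotically nonnegative at the boundary, then `tr((DP)²) = c`. -/
theorem trace_sq_eq_of_boundary_nonneg {Ω : Set E} (hΩ : Bornology.IsBounded Ω)
    (hρ : ContDiff ℝ 2 ρ) (hρΩ : ∀ x, x ∈ Ω ↔ ρ x < 0) {P : E → E} (hP : ContDiffOn ℝ 1 P Ω)
    {c : ℝ} (hdiv : ∀ x ∈ Ω, divergence P x = c)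
    (htr : ∀ x ∈ Ω, c ≤ LinearMap.trace ℝ E (fderiv ℝ P x ∘L fderiv ℝ P x).toLinearMap)
    {X : E → E} {U : Set E} (hU : IsOpen U) (hX : ContDiffOn ℝ 1 X U) {ε₁ : ℝ} (hε₁ : 0 < ε₁)
    (hUΩ : ∀ x ∈ Ω, -ε₁ ≤ ρ x → x ∈ U) (hX0 : ∀ x ∈ U, inner ℝ (gradient ρ x) (X x) = 0)
    (hq : ∀ δ > 0, ∃ ε > 0, ∀ x ∈ Ω, -ε ≤ ρ x → -δ * ‖gradient ρ x‖ ^ 2 ≤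
      inner ℝ (gradient ρ x) (P x - fderiv ℝ P x (P x)) + divergence X x) :
    ∀ x ∈ Ω, LinearMap.trace ℝ E (fderiv ℝ P x ∘L fderiv ℝ P x).toLinearMap = c := by
  have hρ1 : ContDiff ℝ 1 ρ := hρ.of_le (by norm_num)
  have hρc : Continuous ρ := hρ.continuous
  have hΩo : IsOpen Ω := by
    have : Ω = {x | ρ x < 0} := Set.ext hρΩ
    rw [this]; exact isOpen_lt hρc continuous_const
  have hG : ContDiff ℝ 1 (gradient ρ) :=
    (toDual ℝ E).symm.contDiff.comp (hρ.fderiv_right (m := 1) (by norm_num))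
  have hin : ∀ x v, inner ℝ (gradient ρ x) v = fderiv ℝ ρ x v := fun x v => inner_gradient_left
  set T : E → ℝ := fun x => LinearMap.trace ℝ E (fderiv ℝ P x ∘L fderiv ℝ P x).toLinearMap with hT
  have hPc : ContinuousOn P Ω := hP.continuousOn
  have hAc : ContinuousOn (fderiv ℝ P) Ω := hP.continuousOn_fderiv_of_isOpen hΩo (by norm_num)
  have hTc : ContinuousOn T Ω :=
    continuous_trace_toLinearMap.comp_continuousOn (hAc.clm_comp hAc)
  have hXc : ContinuousOn (divergence X) U :=
    continuous_trace_toLinearMap.comp_continuousOn (hX.continuousOn_fderiv_of_isOpen hU (by norm_num))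
  have hHc : Continuous (divergence (gradient ρ)) :=
    continuous_trace_toLinearMap.comp (hG.continuous_fderiv (by norm_num))
  have hsub : ∀ ε > 0, tsupport (layerCutoff ρ ε) ⊆ Ω := fun ε hε x hx =>
    (hρΩ x).2 ((tsupport_layerCutoff_subset hρc hε hx).trans_lt (by linarith))
  have hsubD : ∀ ε > 0, tsupport (layerDensity ρ ε) ⊆ Ω := fun ε hε x hx =>
    (hρΩ x).2 ((tsupport_layerDensity_subset hρc hε hx).2.trans_lt (by linarith))
  have hcpt : ∀ {φ : E → ℝ}, tsupport φ ⊆ Ω → HasCompactSupport φ := fun h =>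
    Metric.isCompact_of_isClosed_isBounded (isClosed_tsupport _) (hΩ.subset h)
  obtain ⟨C, hC⟩ : ∃ C, ∀ x ∈ closure Ω, ‖divergence (gradient ρ) x‖ ≤ C :=
    hΩ.isCompact_closure.exists_bound_of_continuousOn hHc.continuousOn
  intro x₀ hx₀
  by_contra hne
  have hpos : 0 < T x₀ - c := sub_pos.2 (lt_of_le_of_ne (htr x₀ hx₀) (Ne.symm hne))
  -- With this choice `ρ x₀ = -2ε₀`, so the cutoff at scale `ε₀` equals one at `x₀`.
  set ε₀ : ℝ := -ρ x₀ / 2 with hε₀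
  have hρx : ρ x₀ < 0 := (hρΩ x₀).1 hx₀
  have hε₀p : 0 < ε₀ := by rw [hε₀]; linarith
  have hcont0 : Continuous fun x => layerCutoff ρ ε₀ x * (T x - c) :=
    continuous_mul_of_tsupport_subset (contDiff_layerCutoff hρ1).continuous hΩo (hsub _ hε₀p)
      (hTc.sub continuousOn_const)
  have hnn0 : ∀ ε > 0, ∀ x, 0 ≤ layerCutoff ρ ε x * (T x - c) := by
    intro ε hε x
    by_cases hx : x ∈ Ω
    · exact mul_nonneg (layerCutoff_nonneg x) (sub_nonneg.2 (htr x hx))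
    · rw [layerCutoff_eq_zero hε, zero_mul]
      have := not_lt.1 (fun h => hx ((hρΩ x).2 h)); linarith
  have hcs0 : HasCompactSupport fun x => layerCutoff ρ ε₀ x * (T x - c) :=
    (hcpt (hsub _ hε₀p)).mul_right
  have hIpos : 0 < ∫ x, layerCutoff ρ ε₀ x * (T x - c) := by
    refine hcont0.integral_pos_of_hasCompactSupport_nonneg_nonzero (x := x₀) hcs0
      (fun x => hnn0 _ hε₀p x) ?_
    rw [layerCutoff_eq_one hε₀p (by rw [hε₀]; linarith), one_mul]
    exact hpos.ne'
  -- The defect, weighted by a fixed cutoff, is bounded by an arbitrarily small multiple of a fixed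
  -- constant. Finer cutoffs only increase the weighted defect.
  have hbound : ∀ δ > 0, ∫ x, layerCutoff ρ ε₀ x * (T x - c) ≤ δ * (C * volume.real Ω) := by
    intro δ hδ
    obtain ⟨ε₂, hε₂, hqδ⟩ := hq δ hδ
    -- The density reaches down to `ρ = -2ε`, hence the factors 2.
    obtain ⟨ε, hε, he0, he1, he2⟩ : ∃ ε > 0, ε ≤ ε₀ ∧ 2 * ε ≤ ε₁ ∧ 2 * ε ≤ ε₂ := by
      refine ⟨min ε₀ (min (ε₁ / 2) (ε₂ / 2)), by positivity, min_le_left _ _, ?_, ?_⟩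
      · have := (min_le_right ε₀ (min (ε₁ / 2) (ε₂ / 2))).trans (min_le_left _ _); linarith
      · have := (min_le_right ε₀ (min (ε₁ / 2) (ε₂ / 2))).trans (min_le_right _ _); linarith
    set φ := layerCutoff ρ ε with hφ
    set m := layerDensity ρ ε with hm
    have hφC : ContDiff ℝ 1 φ := contDiff_layerCutoff hρ1
    have hmC : ContDiff ℝ 1 m := contDiff_layerDensity hρ1
    have hDφ : ∀ x v, fderiv ℝ φ x v = -(m x * inner ℝ (gradient ρ x) v) := by
      intro x v
      rw [hφ, fderiv_layerCutoff hρ1, hin]; simp [hm]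
    have hmU : tsupport m ⊆ U := fun x hx => hUΩ x (hsubD ε hε hx)
      (by have := (tsupport_layerDensity_subset hρc hε hx).1; linarith)
    -- `e1 - e2 + e4` expresses the weighted defect through the boundary integrand. `e3` controls
    -- the error: it gives `∫ m |∇ρ|² = ∫ φ div ∇ρ`, bounded uniformly in `ε`.
    have e1 := integral_mul_trace_sq_add_eq_zero (μ := volume) hφC (hcpt (hsub ε hε)) hΩo
      (hsub ε hε) hP hdiv
    have e2 := integral_divergence_smul_eq_zero (μ := volume) hφC (hcpt (hsub ε hε)) hΩo
      (hsub ε hε) hP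
    have e3 := integral_divergence_smul_eq_zero (μ := volume) hφC (hcpt (hsub ε hε)) isOpen_univ
      (subset_univ _) hG.contDiffOn
    have e4 := integral_divergence_smul_eq_zero (μ := volume) hmC (hcpt (hsubD ε hε)) hU
      hmU hX
    simp only [hDφ] at e1 e2 e3
    have hDm : ∀ x, fderiv ℝ m x (X x) = 0 := by
      intro x
      obtain ⟨s, hs⟩ := exists_fderiv_layerDensity (ε := ε) hρ1 x
      by_cases hx : x ∈ tsupport m
      · rw [hm, hs, smul_apply, ← hin, hX0 x (hmU hx), smul_zero]
      · rw [fderiv_of_notMem_tsupport ℝ hx]; simp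
    simp only [hDm, add_zero] at e4
    have int1 : Integrable fun x => φ x * T x + -(m x * inner ℝ (gradient ρ x)
        (fderiv ℝ P x (P x))) :=
      ((continuous_mul_of_tsupport_subset hφC.continuous hΩo (hsub ε hε)
        hTc).integrable_of_hasCompactSupport (hcpt (hsub ε hε)).mul_right).add
      ((continuous_mul_of_tsupport_subset hmC.continuous hΩo (hsubD ε hε)
        (hG.continuous.continuousOn.inner (hAc.clm_apply hPc))).integrable_of_hasCompactSupport
          (hcpt (hsubD ε hε)).mul_right).neg
    have hPdc : ContinuousOn (divergence P) Ω :=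
      continuous_trace_toLinearMap.comp_continuousOn hAc
    have int2 : Integrable fun x => φ x * divergence P x + -(m x * inner ℝ (gradient ρ x) (P x)) :=
      ((continuous_mul_of_tsupport_subset hφC.continuous hΩo (hsub ε hε)
        hPdc).integrable_of_hasCompactSupport (hcpt (hsub ε hε)).mul_right).add
      ((continuous_mul_of_tsupport_subset hmC.continuous hΩo (hsubD ε hε)
        (hG.continuous.continuousOn.inner hPc)).integrable_of_hasCompactSupport
          (hcpt (hsubD ε hε)).mul_right).neg
    have int3 : Integrable fun x => φ x * divergence (gradient ρ) x +
        -(m x * inner ℝ (gradient ρ x) (gradient ρ x)) :=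
      ((hφC.continuous.mul hHc).integrable_of_hasCompactSupport
        (hcpt (hsub ε hε)).mul_right).add
      ((hmC.continuous.mul (hG.continuous.inner hG.continuous)).integrable_of_hasCompactSupport
          (hcpt (hsubD ε hε)).mul_right).neg
    have int4 : Integrable fun x => m x * divergence X x :=
      (continuous_mul_of_tsupport_subset hmC.continuous hU hmU hXc).integrable_of_hasCompactSupport
          (hcpt (hsubD ε hε)).mul_right
    have hsum : ∫ x, (((φ x * T x + -(m x * inner ℝ (gradient ρ x) (fderiv ℝ P x (P x)))) -
        (φ x * divergence P x + -(m x * inner ℝ (gradient ρ x) (P x)))) + m x * divergence X x) -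
        δ * (φ x * divergence (gradient ρ) x +
          -(m x * inner ℝ (gradient ρ x) (gradient ρ x))) = 0 := by
      have s1 := integral_sub int1 int2
      have s2 := integral_add (int1.sub int2) int4
      have s3 := integral_sub ((int1.sub int2).add int4) (int3.const_mul δ)
      simp only [Pi.sub_apply, Pi.add_apply] at s1 s2 s3
      rw [s3, s2, s1, integral_const_mul, e3, e4, e2, e1]
      simp
    have hind : Integrable (Ω.indicator fun _ => δ * C) volume :=
      (integrable_indicator_iff hΩo.measurableSet).2
        (integrableOn_const hΩ.measure_lt_top.ne)
    have hle : ∫ x, (layerCutoff ρ ε₀ x * (T x - c) - Ω.indicator (fun _ => δ * C) x) ≤ 0 := by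
      rw [← hsum]
      refine integral_mono ((hcont0.integrable_of_hasCompactSupport hcs0).sub hind)
        (((int1.sub int2).add int4).sub (int3.const_mul δ)) fun x => ?_
      dsimp only
      by_cases hx : x ∈ Ω
      · rw [indicator_of_mem hx, hdiv x hx]
        have h1 : layerCutoff ρ ε₀ x * (T x - c) ≤ φ x * (T x - c) :=
          mul_le_mul_of_nonneg_right (layerCutoff_anti hε he0 ((hρΩ x).1 hx).le)
            (sub_nonneg.2 (htr x hx))
        have h2 : δ * (φ x * divergence (gradient ρ) x) ≤ δ * C := by
          refine mul_le_mul_of_nonneg_left ?_ hδ.le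
          have hb := hC x (subset_closure hx)
          calc φ x * divergence (gradient ρ) x ≤ φ x * C :=
                mul_le_mul_of_nonneg_left ((le_abs_self _).trans hb) (layerCutoff_nonneg x)
            _ ≤ 1 * C := mul_le_mul_of_nonneg_right (layerCutoff_le_one x)
                ((norm_nonneg _).trans hb)
            _ = C := one_mul C
        have h3 : 0 ≤ m x * (inner ℝ (gradient ρ x) (P x - fderiv ℝ P x (P x)) + divergence X x +
            δ * ‖gradient ρ x‖ ^ 2) := by
          by_cases hmx : m x = 0
          · rw [hmx, zero_mul]
          · have := hqδ x hx (by have := (layerDensity_ne_zero hε hmx).1; linarith)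
            exact mul_nonneg (layerDensity_nonneg hε x) (by linarith)
        rw [inner_sub_right] at h3
        rw [real_inner_self_eq_norm_sq]
        nlinarith
      · have hρ0 : 0 ≤ ρ x := not_lt.1 fun h => hx ((hρΩ x).2 h)
        have hm0 : m x = 0 := by
          by_contra h
          have := (layerDensity_ne_zero hε h).2; linarith
        rw [indicator_of_notMem hx, hm0, hφ, layerCutoff_eq_zero hε (by linarith),
          layerCutoff_eq_zero hε₀p (by linarith)]
        simp
    rw [integral_sub (hcont0.integrable_of_hasCompactSupport hcs0) hind,
      integral_indicator hΩo.measurableSet, setIntegral_const, smul_eq_mul] at hle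
    linarith
  set I := ∫ x, layerCutoff ρ ε₀ x * (T x - c) with hI
  have hK : 0 < C * volume.real Ω := by
    have := hbound 1 one_pos; linarith
  -- This `δ` turns the bound into `I ≤ I / 2`, contradicting `I > 0`.
  have := hbound (I / (2 * (C * volume.real Ω))) (by positivity)
  have h2 : I / (2 * (C * volume.real Ω)) * (C * volume.real Ω) = I / 2 := by
    rw [div_mul_eq_mul_div, div_eq_div_iff (by positivity) two_ne_zero]; ring
  linarith

end Layer

/-! ### A global defining function -/

section GlobalDefiningFunction

variable {N : ℕ} {Ω : Set (EuclideanSpace ℝ (Fin N))}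

/-- All local defining functions increase along the same normal, so a sum of them with nonnegative
weights, not all zero, cannot have a critical point on the boundary. -/
theorem IsDefiningFunctionAt.fderiv_outerNormal_pos {p : EuclideanSpace ℝ (Fin N)}
    {ρ : EuclideanSpace ℝ (Fin N) → ℝ} (hρ : IsDefiningFunctionAt Ω p ρ) (hp : p ∈ frontier Ω) :
    0 < fderiv ℝ ρ p (outerNormal Ω p) := by
  have h0 : 0 < ‖gradient ρ p‖ := norm_pos_iff.2 hρ.gradient_ne_zero
  rw [outerNormal_eq hp hρ, ← inner_gradient_left, real_inner_smul_right,
    real_inner_self_eq_norm_sq]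
  positivity

theorem IsDefiningFunctionAt.eventually {p : EuclideanSpace ℝ (Fin N)}
    {ρ : EuclideanSpace ℝ (Fin N) → ℝ} (hρ : IsDefiningFunctionAt Ω p ρ) :
    ∀ᶠ x in 𝓝 p, IsDefiningFunctionAt Ω x ρ := by
  have hc : ContinuousAt (gradient ρ) p :=
    (toDual ℝ (EuclideanSpace ℝ (Fin N))).symm.continuous.continuousAt.comp
      (hρ.contDiffAt.fderiv_right (m := 1) (by norm_num)).continuousAt
  filter_upwards [hρ.contDiffAt.eventually (by simp), hc.eventually_ne hρ.gradient_ne_zero,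
    hρ.mem_iff.eventually_nhds] with x h1 h2 h3
  exact ⟨h1, h2, h3⟩

/-- A bounded domain with `C²` boundary has a global `C²` defining function. -/
theorem exists_global_definingFunction (hΩ : IsOpen Ω) (hb : Bornology.IsBounded Ω)
    (hC : HasC2Boundary Ω) :
    ∃ ρ : EuclideanSpace ℝ (Fin N) → ℝ, ContDiff ℝ 2 ρ ∧ (∀ x, x ∈ Ω ↔ ρ x < 0) ∧
      ∀ p ∈ frontier Ω, gradient ρ p ≠ 0 := by
  classical
  have hloc : ∀ p : EuclideanSpace ℝ (Fin N), ∃ (σ : EuclideanSpace ℝ (Fin N) → ℝ) (r : ℝ), 0 < r ∧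
      (p ∈ frontier Ω → ∀ x ∈ Metric.ball p r, IsDefiningFunctionAt Ω x σ) := by
    intro p
    by_cases hp : p ∈ frontier Ω
    · obtain ⟨σ, hσ⟩ := hC p hp
      obtain ⟨r, hr, hr'⟩ := Metric.eventually_nhds_iff_ball.1 hσ.eventually
      exact ⟨σ, r, hr, fun _ => hr'⟩
    · exact ⟨0, 1, one_pos, fun h => absurd h hp⟩
  choose σ r hr hσ using hloc
  have hΓ : IsCompact (frontier Ω) :=
    hb.isCompact_closure.of_isClosed_subset isClosed_frontier frontier_subset_closure
  obtain ⟨t, htΓ, htc⟩ := hΓ.elim_nhds_subcover (fun p => Metric.ball p (r p / 3))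
    fun p _ => Metric.ball_mem_nhds p (by have := hr p; positivity)
  let b : ∀ p : EuclideanSpace ℝ (Fin N), ContDiffBump p := fun p =>
    ⟨r p / 3, r p / 2, by have := hr p; positivity, by have := hr p; linarith⟩
  have hbs : ∀ p, tsupport (b p) ⊆ Metric.ball p (r p) := by
    intro p
    rw [(b p).tsupport_eq]
    exact Metric.closedBall_subset_ball (by have := hr p; change r p / 2 < r p; linarith)
  have hb1 : ∀ p, ∀ x ∈ Metric.ball p (r p / 3), (b p : _ → ℝ) =ᶠ[𝓝 x] 1 := fun p x hx =>
    (b p).eventuallyEq_one_of_mem_ball hx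
  have hnn : ∀ p x, 0 ≤ b p x := fun p x => (b p).nonneg
  have hle : ∀ p x, b p x ≤ 1 := fun p x => (b p).le_one
  have hact : ∀ p ∈ t, ∀ x, b p x ≠ 0 → IsDefiningFunctionAt Ω x (σ p) := fun p hp x hx =>
    hσ p (htΓ p hp) x (hbs p (subset_tsupport _ hx))
  set S : EuclideanSpace ℝ (Fin N) → ℝ := fun x => ∑ p ∈ t, b p x * σ p x with hS
  set s : EuclideanSpace ℝ (Fin N) → ℝ := fun x => if x ∈ Ω then -1 else 1 with hs
  -- The term `s π` fixes the sign where all bumps vanish. The jump of `s` across `∂Ω` is harmless,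
  -- since `π` is zero near the boundary.
  set π : EuclideanSpace ℝ (Fin N) → ℝ := fun x => ∏ p ∈ t, (1 - b p x) with hπ
  have hπnn : ∀ x, 0 ≤ π x := fun x => Finset.prod_nonneg fun p _ => sub_nonneg.2 (hle p x)
  have hSC : ∀ p ∈ t, ContDiff ℝ 2 fun x => b p x * σ p x := by
    intro p hp
    exact contDiff_smul_of_tsupport_subset (b p).contDiff Metric.isOpen_ball (hbs p)
      fun x hx => (hσ p (htΓ p hp) x hx).contDiffAt.contDiffWithinAt
  have hπ0 : ∀ p ∈ frontier Ω, (fun x => s x * π x) =ᶠ[𝓝 p] 0 := by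
    intro p hp
    obtain ⟨q, hq, hpq⟩ := mem_iUnion₂.1 (htc hp)
    filter_upwards [hb1 q p hpq] with x hx
    have : π x = 0 := Finset.prod_eq_zero hq (by rw [hx]; simp)
    simp [this]
  have hπC : ContDiff ℝ 2 fun x => s x * π x := by
    rw [contDiff_iff_contDiffAt]
    intro x
    have hπc : ContDiffAt ℝ 2 π x :=
      contDiffAt_prod fun p _ => contDiffAt_const.sub (b p).contDiffAt
    by_cases hx : x ∈ frontier Ω
    · exact (contDiffAt_const (c := (0 : ℝ))).congr_of_eventuallyEq (hπ0 x hx)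
    · by_cases hxΩ : x ∈ Ω
      · refine ((contDiffAt_const (c := (-1 : ℝ))).mul hπc).congr_of_eventuallyEq ?_
        filter_upwards [hΩ.mem_nhds hxΩ] with y hy
        simp [hs, hy]
      · have hxc : x ∉ closure Ω := fun h => hx ⟨h, by rwa [hΩ.interior_eq]⟩
        refine ((contDiffAt_const (c := (1 : ℝ))).mul hπc).congr_of_eventuallyEq ?_
        filter_upwards [isClosed_closure.isOpen_compl.mem_nhds hxc] with y hy
        have : y ∉ Ω := fun h => hy (subset_closure h)
        simp [hs, this]
  refine ⟨fun x => S x + s x * π x, (ContDiff.sum hSC).add hπC, fun x => ⟨fun hx => ?_, ?_⟩, ?_⟩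
  · have hterm : ∀ p ∈ t, b p x * σ p x ≤ 0 := by
      intro p hp
      by_cases h0 : b p x = 0
      · simp [h0]
      · exact mul_nonpos_of_nonneg_of_nonpos (hnn p x)
          ((hact p hp x h0).mem_iff.self_of_nhds.1 hx).le
    have hsx : s x = -1 := by simp [hs, hx]
    simp only [hsx]
    by_cases hall : ∀ p ∈ t, b p x = 0
    · have h1 : π x = 1 := Finset.prod_eq_one fun p hp => by rw [hall p hp, sub_zero]
      have := Finset.sum_nonpos hterm
      change S x ≤ 0 at this
      linarith
    · push Not at hall
      obtain ⟨p, hp, hpx⟩ := hall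
      have : S x < 0 := Finset.sum_neg' hterm ⟨p, hp, mul_neg_of_pos_of_neg
        (lt_of_le_of_ne (hnn p x) (Ne.symm hpx)) ((hact p hp x hpx).mem_iff.self_of_nhds.1 hx)⟩
      have := hπnn x
      linarith
  · intro h
    by_contra hx
    have hterm : ∀ p ∈ t, 0 ≤ b p x * σ p x := by
      intro p hp
      by_cases h0 : b p x = 0
      · simp [h0]
      · exact mul_nonneg (hnn p x)
          (not_lt.1 fun h => hx ((hact p hp x h0).mem_iff.self_of_nhds.2 h))
    have hsx : s x = 1 := by simp [hs, hx]
    simp only [hsx] at h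
    have h1 : 0 ≤ S x := Finset.sum_nonneg hterm
    have := hπnn x
    linarith
  · intro x hx hg
    have heq : (fun x => S x + s x * π x) =ᶠ[𝓝 x] S := by
      filter_upwards [hπ0 x hx] with y hy
      simp only [hy, Pi.zero_apply, add_zero]
    have hdS : fderiv ℝ S x (outerNormal Ω x) =
        ∑ p ∈ t, fderiv ℝ (fun x => b p x * σ p x) x (outerNormal Ω x) := by
      rw [hS, fderiv_fun_sum fun p hp => (hSC p hp).differentiable (by norm_num) x]
      simp
    -- On the boundary `σ p` vanishes, so the derivative of the bump drops out of the product rule.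
    have hterm : ∀ p ∈ t, x ∈ tsupport (b p) →
        fderiv ℝ (fun x => b p x * σ p x) x (outerNormal Ω x) =
          b p x * fderiv ℝ (σ p) x (outerNormal Ω x) ∧
        0 < fderiv ℝ (σ p) x (outerNormal Ω x) := by
      intro p hp hxp
      have hd := hσ p (htΓ p hp) x (hbs p hxp)
      refine ⟨?_, hd.fderiv_outerNormal_pos hx⟩
      rw [fderiv_fun_mul ((b p).contDiff.contDiffAt.differentiableAt (n := 1) (by norm_num))
        (hd.contDiffAt.differentiableAt (by norm_num)), hd.apply_eq_zero hx]
      simp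
    obtain ⟨q, hq, hxq⟩ := mem_iUnion₂.1 (htc hx)
    have hq1 : b q x = 1 := (hb1 q x hxq).self_of_nhds
    have hpos : 0 < fderiv ℝ S x (outerNormal Ω x) := by
      rw [hdS]
      refine Finset.sum_pos' (fun p hp => ?_) ⟨q, hq, ?_⟩
      · by_cases hxp : x ∈ tsupport (b p)
        · rw [(hterm p hp hxp).1]
          exact mul_nonneg (hnn p x) (hterm p hp hxp).2.le
        · rw [fderiv_of_notMem_tsupport ℝ fun h => hxp (tsupport_mul_subset_left h)]
          simp
      · have := hterm q hq (subset_tsupport _ (by rw [Function.mem_support, hq1]; exact one_ne_zero))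
        rw [this.1, hq1, one_mul]
        exact this.2
    rw [← heq.fderiv_eq, ← inner_gradient_left, hg, inner_zero_left] at hpos
    exact lt_irrefl _ hpos

end GlobalDefiningFunction

/-! ### Derivatives up to the boundary, and uniform layers -/

section BoundaryRegularity

variable {N : ℕ} {Ω : Set (EuclideanSpace ℝ (Fin N))}

theorem IsDefiningFunctionAt.mem_tangentConeAt_closure {p : EuclideanSpace ℝ (Fin N)}
    {ρ : EuclideanSpace ℝ (Fin N) → ℝ} (hρ : IsDefiningFunctionAt Ω p ρ) (hp : p ∈ frontier Ω)
    {w : EuclideanSpace ℝ (Fin N)} (hw : inner ℝ (gradient ρ p) w < 0) :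
    w ∈ tangentConeAt ℝ (closure Ω) p := by
  have h0 : Tendsto (fun t : ℝ => t) (𝓝[>] 0) (𝓝 0) := nhdsWithin_le_nhds
  refine mem_tangentConeAt_of_add_smul_mem (l := 𝓝[>] (0 : ℝ)) (c := fun t => t) ?_ ?_
  · exact tendsto_nhdsWithin_iff.2 ⟨h0, by
      filter_upwards [self_mem_nhdsWithin] with t ht using (ne_of_gt ht : t ≠ 0)⟩
  · filter_upwards [(hρ.ray_mem hp w).1 hw] with t ht using subset_closure ht

/-- At a boundary point the inward directions form an open half-space, which spans. Hence
`fderivWithin` on the closure is determined there. -/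
theorem uniqueDiffOn_closure (hΩ : IsOpen Ω) (hC : HasC2Boundary Ω) :
    UniqueDiffOn ℝ (closure Ω) := by
  intro p hp
  by_cases hpΩ : p ∈ Ω
  · exact (hΩ.uniqueDiffOn (𝕜 := ℝ) p hpΩ).mono subset_closure
  · have hpf : p ∈ frontier Ω := ⟨hp, by rwa [hΩ.interior_eq]⟩
    obtain ⟨ρ, hρ⟩ := hC p hpf
    refine ⟨?_, subset_closure hp⟩
    have htop : Submodule.span ℝ (tangentConeAt ℝ (closure Ω) p) = ⊤ := by
      rw [eq_top_iff]
      intro v _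
      set g := gradient ρ p with hg
      have hg0 : 0 < ‖g‖ ^ 2 := by have := norm_pos_iff.2 hρ.gradient_ne_zero; positivity
      -- `k` is large enough that `v - k • g` points inward, as `-(k • g)` does; their difference is
      -- `v`.
      set k : ℝ := (|inner ℝ g v| + 1) / ‖g‖ ^ 2 with hk
      have hk0 : k * ‖g‖ ^ 2 = |inner ℝ g v| + 1 := div_mul_cancel₀ _ hg0.ne'
      have h1 : v - k • g ∈ tangentConeAt ℝ (closure Ω) p := by
        refine hρ.mem_tangentConeAt_closure hpf ?_
        rw [inner_sub_right, real_inner_smul_right, real_inner_self_eq_norm_sq, hk0]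
        have := le_abs_self (inner ℝ g v)
        linarith
      have h2 : -(k • g) ∈ tangentConeAt ℝ (closure Ω) p := by
        refine hρ.mem_tangentConeAt_closure hpf ?_
        rw [inner_neg_right, real_inner_smul_right, real_inner_self_eq_norm_sq, hk0]
        have := abs_nonneg (inner ℝ g v)
        linarith
      have := Submodule.sub_mem (Submodule.span ℝ (tangentConeAt ℝ (closure Ω) p)) (Submodule.subset_span h1) (Submodule.subset_span h2)
      simpa using this
    rw [htop]
    exact dense_univ

/-- A property that holds near the boundary holds on a sublevel layer `{-ε ≤ ρ < 0}`. -/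
theorem exists_layer_of_eventually {ρ : EuclideanSpace ℝ (Fin N) → ℝ}
    (hb : Bornology.IsBounded Ω) (hρ : Continuous ρ) (hρΩ : ∀ x, x ∈ Ω ↔ ρ x < 0)
    {Q : EuclideanSpace ℝ (Fin N) → Prop}
    (hQ : ∀ p ∈ frontier Ω, ∀ᶠ x in 𝓝[closure Ω] p, Q x) :
    ∃ ε > 0, ∀ x ∈ Ω, -ε ≤ ρ x → Q x := by
  have hΩ : IsOpen Ω := by
    have : Ω = {x | ρ x < 0} := Set.ext hρΩ
    rw [this]; exact isOpen_lt hρ continuous_const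
  set V := {x | ∀ᶠ y in 𝓝 x, y ∈ closure Ω → Q y} with hV
  have hVo : IsOpen V := isOpen_iff_mem_nhds.2 fun x hx => eventually_eventually_nhds.2 hx
  have hK : IsCompact (closure Ω \ V) := hb.isCompact_closure.diff hVo
  have hKneg : ∀ x ∈ closure Ω \ V, ρ x < 0 := by
    intro x hx
    rw [← hρΩ]
    by_contra h
    exact hx.2 (eventually_nhdsWithin_iff.1 (hQ x ⟨hx.1, by rwa [hΩ.interior_eq]⟩))
  have hout : ∀ x ∈ Ω, x ∉ closure Ω \ V → Q x := by
    intro x hx h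
    have hxV : x ∈ V := by
      by_contra h'
      exact h ⟨subset_closure hx, h'⟩
    exact Eventually.self_of_nhds hxV (subset_closure hx)
  rcases (closure Ω \ V).eq_empty_or_nonempty with he | hne
  · exact ⟨1, one_pos, fun x hx _ => hout x hx (by simp [he])⟩
  · obtain ⟨y, hy, hmax⟩ := hK.exists_isMaxOn hne hρ.continuousOn
    have hy0 := hKneg y hy
    -- Points of the bad compact set satisfy `ρ ≤ ρ y < ρ y / 2`, so the layer misses it.
    refine ⟨-ρ y / 2, by linarith, fun x hx hxε => hout x hx fun hxK => ?_⟩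
    have := hmax hxK
    change ρ x ≤ ρ y at this
    linarith

end BoundaryRegularity

/-! ### Hessians and principal curvatures -/

section Curvature

variable {N : ℕ} {Ω : Set (EuclideanSpace ℝ (Fin N))}

/-- The Riesz isomorphism of a real Hilbert space, as a linear equivalence. -/
def rieszEquiv (E : Type*) [NormedAddCommGroup E] [InnerProductSpace ℝ E] [CompleteSpace E] :
    StrongDual ℝ E ≃L[ℝ] E where
  toFun := (toDual ℝ E).symm
  invFun := toDual ℝ E
  map_add' := map_add _
  map_smul' c x := by simp
  left_inv := (toDual ℝ E).apply_symm_apply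
  right_inv := (toDual ℝ E).symm_apply_apply
  continuous_toFun := (toDual ℝ E).symm.continuous
  continuous_invFun := (toDual ℝ E).continuous

theorem inner_fderivWithin_gradientWithin {E : Type*} [NormedAddCommGroup E]
    [InnerProductSpace ℝ E] [CompleteSpace E] {u : E → ℝ} {s : Set E} (hs : UniqueDiffOn ℝ s)
    {x : E} (hx : x ∈ s) (v w : E) :
    inner ℝ (fderivWithin ℝ (gradientWithin u s) s x v) w =
      fderivWithin ℝ (fderivWithin ℝ u s) s x v w := by
  have h : fderivWithin ℝ (gradientWithin u s) s x =
      (rieszEquiv E : StrongDual ℝ E →L[ℝ] E) ∘L fderivWithin ℝ (fderivWithin ℝ u s) s x :=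
    (rieszEquiv E).comp_fderivWithin (hs x hx)
  rw [h]
  exact toDual_symm_apply

theorem inner_fderiv_gradient {E : Type*} [NormedAddCommGroup E]
    [InnerProductSpace ℝ E] [CompleteSpace E] {u : E → ℝ} (x v w : E) :
    inner ℝ (fderiv ℝ (gradient u) x v) w = fderiv ℝ (fderiv ℝ u) x v w := by
  have h := inner_fderivWithin_gradientWithin (u := u) uniqueDiffOn_univ (mem_univ x) v w
  simpa only [fderivWithin_univ, gradientWithin_univ] using h

theorem inner_fderiv_gradient_comm {E : Type*} [NormedAddCommGroup E]
    [InnerProductSpace ℝ E] [CompleteSpace E] {u : E → ℝ} {x : E} (hu : ContDiffAt ℝ 2 u x)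
    (v w : E) :
    inner ℝ (fderiv ℝ (gradient u) x v) w = inner ℝ (fderiv ℝ (gradient u) x w) v := by
  rw [inner_fderiv_gradient, inner_fderiv_gradient]
  exact hu.isSymmSndFDerivAt (by simp) v w

variable {p : EuclideanSpace ℝ (Fin N)} {ρ : EuclideanSpace ℝ (Fin N) → ℝ}

theorem IsDefiningFunctionAt.norm_outerNormal (hρ : IsDefiningFunctionAt Ω p ρ)
    (hp : p ∈ frontier Ω) : ‖outerNormal Ω p‖ = 1 := by
  rw [outerNormal_eq hp hρ]
  exact norm_smul_inv_norm (𝕜 := ℝ) hρ.gradient_ne_zero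

theorem isSymmetric_shapeOperator (hρ : IsDefiningFunctionAt Ω p ρ) (hp : p ∈ frontier Ω) :
    (shapeOperator Ω p).IsSymmetric := by
  intro v w
  rw [inner_shapeOperator hp hρ, real_inner_comm, inner_shapeOperator hp hρ]
  congr 1
  exact hρ.contDiffAt.isSymmSndFDerivAt (by simp) _ _

theorem finrank_tangentSpaceAt (hρ : IsDefiningFunctionAt Ω p ρ) (hp : p ∈ frontier Ω)
    (hN : 2 ≤ N) : Module.finrank ℝ (tangentSpaceAt Ω p) = N - 1 := by
  have : Fact (Module.finrank ℝ (EuclideanSpace ℝ (Fin N)) = (N - 1) + 1) :=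
    ⟨by rw [finrank_euclideanSpace_fin]; omega⟩
  refine Submodule.finrank_orthogonal_span_singleton (𝕜 := ℝ) (n := N - 1) ?_
  rw [← norm_pos_iff, hρ.norm_outerNormal hp]
  exact one_pos

/-- `minCurvature` is a real `sInf`, a genuine lower bound only if the set is bounded below. Each
curvature is a Rayleigh quotient of the normalised Hessian, which is bounded on the compact
boundary. -/
theorem bddBelow_principalCurvatures (hb : Bornology.IsBounded Ω) (hρ : ContDiff ℝ 2 ρ)
    (hdef : ∀ p ∈ frontier Ω, IsDefiningFunctionAt Ω p ρ) :
    BddBelow {κ : ℝ | ∃ p ∈ frontier Ω, κ ∈ principalCurvatures Ω p} := by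
  have hΓ : IsCompact (frontier Ω) :=
    hb.isCompact_closure.of_isClosed_subset isClosed_frontier frontier_subset_closure
  have hG : ContDiff ℝ 1 (gradient ρ) :=
    (toDual ℝ (EuclideanSpace ℝ (Fin N))).symm.contDiff.comp
      (hρ.fderiv_right (m := 1) (by norm_num))
  obtain ⟨C, hC⟩ : ∃ C, ∀ x ∈ frontier Ω, ‖‖gradient ρ x‖⁻¹ * ‖fderiv ℝ (gradient ρ) x‖‖ ≤ C := by
    refine hΓ.exists_bound_of_continuousOn ?_
    refine ContinuousOn.mul (hG.continuous.norm.continuousOn.inv₀ fun x hx => ?_)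
      (hG.continuous_fderiv (by norm_num)).norm.continuousOn
    exact norm_ne_zero_iff.2 (hdef x hx).gradient_ne_zero
  refine ⟨-C, ?_⟩
  rintro κ ⟨x, hx, hκ⟩
  have hev : Module.End.HasEigenvalue (shapeOperator Ω x) κ :=
    (Module.End.hasEigenvalue_iff_isRoot_charpoly _ _).2 (Polynomial.isRoot_of_mem_roots hκ)
  obtain ⟨v, hv⟩ := hev.exists_hasEigenvector
  have h1 := inner_shapeOperator hx (hdef x hx) v v
  rw [hv.apply_eq_smul, real_inner_smul_left, real_inner_self_eq_norm_sq,
    ← inner_fderiv_gradient] at h1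
  have h2 : |inner ℝ (fderiv ℝ (gradient ρ) x v) (v : EuclideanSpace ℝ (Fin N))| ≤
      ‖fderiv ℝ (gradient ρ) x‖ * ‖v‖ ^ 2 := by
    refine (abs_real_inner_le_norm _ _).trans ?_
    rw [pow_two, ← mul_assoc]
    exact mul_le_mul_of_nonneg_right (ContinuousLinearMap.le_opNorm _ _) (norm_nonneg _)
  have h3 : 0 < ‖v‖ ^ 2 := by have := norm_pos_iff.2 hv.2; positivity
  have h4 := (le_abs_self _).trans (hC x hx)
  have h5 := inv_nonneg.2 (norm_nonneg (gradient ρ x))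
  have h6 : -(C * ‖v‖ ^ 2) ≤ κ * ‖v‖ ^ 2 := by
    rw [h1]
    have h7 := mul_le_mul_of_nonneg_left (neg_le_of_abs_le h2) h5
    have h8 := mul_le_mul_of_nonneg_right h4 h3.le
    linarith
  have h7 : -C * ‖v‖ ^ 2 ≤ κ * ‖v‖ ^ 2 := by linarith
  exact le_of_mul_le_mul_right h7 h3

theorem minCurvature_le (hbdd : BddBelow {κ : ℝ | ∃ p ∈ frontier Ω, κ ∈ principalCurvatures Ω p})
    (hp : p ∈ frontier Ω) {κ : ℝ} (hκ : κ ∈ principalCurvatures Ω p) : minCurvature Ω ≤ κ :=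
  csInf_le hbdd ⟨p, hp, hκ⟩

/-- The shape operator is symmetric, so the form is diagonal in an orthonormal eigenbasis, with
principal curvatures as coefficients. -/
theorem minCurvature_mul_le (hρ : IsDefiningFunctionAt Ω p ρ) (hp : p ∈ frontier Ω)
    (hbdd : BddBelow {κ : ℝ | ∃ p ∈ frontier Ω, κ ∈ principalCurvatures Ω p})
    (v : tangentSpaceAt Ω p) :
    minCurvature Ω * ‖v‖ ^ 2 ≤ inner ℝ (shapeOperator Ω p v) v := by
  have hS := isSymmetric_shapeOperator hρ hp
  set e := hS.eigenvectorBasis rfl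
  rw [← e.sum_inner_mul_inner, ← real_inner_self_eq_norm_sq, ← e.sum_inner_mul_inner,
    Finset.mul_sum]
  refine Finset.sum_le_sum fun i _ => ?_
  have h1 : inner ℝ (shapeOperator Ω p v) (e i) = hS.eigenvalues rfl i * inner ℝ v (e i) := by
    rw [hS, hS.apply_eigenvectorBasis rfl i, real_inner_smul_right]; rfl
  have h2 : minCurvature Ω ≤ hS.eigenvalues rfl i := by
    refine minCurvature_le hbdd hp ?_
    rw [principalCurvatures, hS.roots_charpoly_eq_eigenvalues rfl]
    exact Multiset.mem_map_of_mem _ (Finset.mem_univ_val i)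
  rw [h1, mul_assoc, real_inner_comm v (e i)]
  exact mul_le_mul_of_nonneg_right h2 (mul_self_nonneg _)

theorem minCurvature_le_meanCurvature (hN : 2 ≤ N) (hρ : IsDefiningFunctionAt Ω p ρ)
    (hp : p ∈ frontier Ω)
    (hbdd : BddBelow {κ : ℝ | ∃ p ∈ frontier Ω, κ ∈ principalCurvatures Ω p}) :
    minCurvature Ω ≤ meanCurvature Ω p := by
  have hS := isSymmetric_shapeOperator hρ hp
  have hcard : (principalCurvatures Ω p).card = N - 1 := by
    rw [principalCurvatures, hS.roots_charpoly_eq_eigenvalues (finrank_tangentSpaceAt hρ hp hN)]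
    simp
  have h := Multiset.card_nsmul_le_sum (s := principalCurvatures Ω p) (a := minCurvature Ω)
    fun κ hκ => minCurvature_le hbdd hp hκ
  have hN1 : (0 : ℝ) < (N : ℝ) - 1 := by
    have : (2 : ℝ) ≤ N := by exact_mod_cast hN
    linarith
  rw [hcard, nsmul_eq_mul, Nat.cast_sub (by omega), Nat.cast_one] at h
  rw [meanCurvature, le_div_iff₀ hN1]
  linarith

/-- The mean curvature in terms of the Hessian of a defining function. -/
theorem meanCurvature_eq (hN : 2 ≤ N) (hρ : IsDefiningFunctionAt Ω p ρ) (hp : p ∈ frontier Ω) :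
    ((N : ℝ) - 1) * meanCurvature Ω p * ‖gradient ρ p‖ = divergence (gradient ρ) p -
      inner ℝ (fderiv ℝ (gradient ρ) p (gradient ρ p)) (gradient ρ p) / ‖gradient ρ p‖ ^ 2 := by
  set g := gradient ρ p with hg
  set H := fderiv ℝ (gradient ρ) p with hH
  have hS := isSymmetric_shapeOperator hρ hp
  have hg0 : ‖g‖ ≠ 0 := norm_ne_zero_iff.2 hρ.gradient_ne_zero
  have hN1 : (N : ℝ) - 1 ≠ 0 := by
    have : (2 : ℝ) ≤ N := by exact_mod_cast hN
    linarith
  have htr : (principalCurvatures Ω p).sum = LinearMap.trace ℝ _ (shapeOperator Ω p) :=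
    (Module.End.trace_eq_sum_roots_charpoly_of_splits hS.splits_charpoly).symm
  rw [meanCurvature, htr, mul_div_cancel₀ _ hN1]
  set K := tangentSpaceAt Ω p with hK
  set n := outerNormal Ω p with hn
  have hcomp : ‖g‖ • shapeOperator Ω p =
      (K.orthogonalProjectionOnto.toLinearMap ∘ₗ H.toLinearMap) ∘ₗ K.subtype := by
    refine LinearMap.ext fun v => ext_inner_right ℝ fun w => ?_
    rw [LinearMap.smul_apply, real_inner_smul_left, inner_shapeOperator hp hρ,
      ← inner_fderiv_gradient, mul_inv_cancel_left₀ hg0]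
    exact (Submodule.inner_orthogonalProjectionOnto_eq_of_mem_right w _).symm
  have hproj : K.subtype ∘ₗ K.orthogonalProjectionOnto.toLinearMap =
      LinearMap.id - (innerSL ℝ n).toLinearMap.smulRight n := by
    refine LinearMap.ext fun v => ?_
    have h := Submodule.starProjection_orthogonal_val (K := Submodule.span ℝ {n}) v
    rw [Submodule.starProjection_unit_singleton ℝ (hρ.norm_outerNormal hp)] at h
    exact h
  -- Cyclicity of the trace moves the computation from the tangent space to the whole space, where
  -- the projection is `id - n ⊗ n`.
  have h1 : LinearMap.trace ℝ _ (shapeOperator Ω p) * ‖g‖ =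
      LinearMap.trace ℝ _ ((H.toLinearMap) ∘ₗ (K.subtype ∘ₗ K.orthogonalProjectionOnto.toLinearMap)) := by
    rw [mul_comm, ← smul_eq_mul, ← map_smul, hcomp, ← LinearMap.trace_comp_cycle']
    rfl
  rw [h1, hproj, LinearMap.comp_sub, map_sub, LinearMap.comp_id]
  have h2 : H.toLinearMap ∘ₗ (innerSL ℝ n).toLinearMap.smulRight n =
      (innerSL ℝ n).toLinearMap.smulRight (H n) := by
    ext v
    simp
  rw [h2, LinearMap.trace_smulRight]
  congr 1
  change inner ℝ n (H n) = _
  rw [hn, outerNormal_eq hp hρ, map_smul, real_inner_smul_left, real_inner_smul_right,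
    real_inner_comm, ← hg]
  field_simp

end Curvature

/-! ### The tangential field and its divergence -/

section TangentField

variable {E : Type*} [NormedAddCommGroup E] [InnerProductSpace ℝ E]

theorem hasFDerivAt_norm_comp {G : E → E} {H : E →L[ℝ] E} {x : E} (hG : HasFDerivAt G H x)
    (h0 : G x ≠ 0) : HasFDerivAt (fun y => ‖G y‖) (‖G x‖⁻¹ • (innerSL ℝ (G x) ∘L H)) x := by
  have h1 : HasFDerivAt (fun y => ‖G y‖ ^ 2) (2 • (innerSL ℝ (G x) ∘L H)) x := hG.norm_sq
  have h2 := h1.sqrt (pow_ne_zero 2 (norm_ne_zero_iff.2 h0))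
  simp only [Real.sqrt_sq (norm_nonneg _)] at h2
  convert h2 using 1
  ext v
  simp
  field_simp

/-- The field `(f / |G|) (|G|² P - ⟨G, P⟩ G)`, which is orthogonal to `G`. -/
def tangentField (f : E → ℝ) (P G : E → E) (y : E) : E :=
  (f y * ‖G y‖⁻¹) • (‖G y‖ ^ 2 • P y - inner ℝ (G y) (P y) • G y)

theorem inner_tangentField (f : E → ℝ) (P G : E → E) (y : E) :
    inner ℝ (G y) (tangentField f P G y) = 0 := by
  rw [tangentField, real_inner_smul_right, inner_sub_right, real_inner_smul_right,
    real_inner_smul_right, real_inner_self_eq_norm_sq]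
  ring

/-- This is the expansion of the squared Hilbert–Schmidt norm of `L - id` for symmetric `L`. When
the trace of `L` is the dimension, it shows that `tr(L²)` is at least the dimension, with equality
only for `L = id`. -/
theorem trace_sq_sub_two_mul_trace {ι : Type*} [Fintype ι] (e : OrthonormalBasis ι ℝ E)
    (L : E →L[ℝ] E) (hL : ∀ v w, inner ℝ (L v) w = inner ℝ (L w) v) :
    LinearMap.trace ℝ E (L ∘L L).toLinearMap - 2 * LinearMap.trace ℝ E L.toLinearMap +
      Fintype.card ι = ∑ i, ‖L (e i) - e i‖ ^ 2 := by
  rw [LinearMap.trace_eq_sum_inner _ e, LinearMap.trace_eq_sum_inner _ e, Finset.mul_sum,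
    ← Finset.sum_sub_distrib, ← Finset.card_univ, ← nsmul_one, ← Finset.sum_const,
    ← Finset.sum_add_distrib]
  refine Finset.sum_congr rfl fun i _ => ?_
  rw [norm_sub_sq_real, e.norm_eq_one, ← real_inner_self_eq_norm_sq]
  simp only [ContinuousLinearMap.coe_coe, ContinuousLinearMap.comp_apply]
  rw [real_inner_comm, hL, real_inner_comm (e i) (L (e i))]
  ring

variable [FiniteDimensional ℝ E]

/-- The terms with `DG` applied to `P` cancel by symmetry of `DG`. For `G = ∇ρ` the remaining `DG`
terms form the bracket that `meanCurvature_eq` identifies on the boundary. -/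
theorem divergence_tangentField {f : E → ℝ} {P G : E → E} {x : E} {β : ℝ}
    (hf : DifferentiableAt ℝ f x) (hP : DifferentiableAt ℝ P x) (hG : DifferentiableAt ℝ G x)
    (h0 : G x ≠ 0) (hDf : ∀ v, fderiv ℝ f x v = β * inner ℝ (P x) v)
    (hsymm : ∀ v w, inner ℝ (fderiv ℝ G x v) w = inner ℝ (fderiv ℝ G x w) v) :
    divergence (tangentField f P G) x =
      β * (‖G x‖ * ‖P x‖ ^ 2 - inner ℝ (G x) (P x) ^ 2 * ‖G x‖⁻¹) + f x * ‖G x‖⁻¹ *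
        (‖G x‖ ^ 2 * divergence P x - inner ℝ (G x) (fderiv ℝ P x (G x)) -
          inner ℝ (G x) (P x) * (divergence G x -
            inner ℝ (fderiv ℝ G x (G x)) (G x) / ‖G x‖ ^ 2)) := by
  have hr0 : ‖G x‖ ≠ 0 := norm_ne_zero_iff.2 h0
  have hn := hasFDerivAt_norm_comp hG.hasFDerivAt h0
  have hζ : HasFDerivAt (fun y => f y * ‖G y‖⁻¹) _ x := 
    hf.hasFDerivAt.mul ((hasDerivAt_inv hr0).comp_hasFDerivAt x hn)
  have ha : HasFDerivAt (fun y => ‖G y‖ ^ 2) (2 • (innerSL ℝ (G x) ∘L fderiv ℝ G x)) x :=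
    hG.hasFDerivAt.norm_sq
  have hb : HasFDerivAt (fun y => inner ℝ (G y) (P y)) _ x := hG.hasFDerivAt.inner ℝ hP.hasFDerivAt
  have haP : DifferentiableAt ℝ (fun y => ‖G y‖ ^ 2 • P y) x := ha.differentiableAt.smul hP
  have hbG : DifferentiableAt ℝ (fun y => inner ℝ (G y) (P y) • G y) x :=
    hb.differentiableAt.smul hG
  have key : divergence (tangentField f P G) x = _ :=
    divergence_smul hζ.differentiableAt (haP.sub hbG)
  rw [key, divergence_sub haP hbG, divergence_smul ha.differentiableAt hP,
    divergence_smul hb.differentiableAt hG, hζ.fderiv, ha.fderiv, hb.fderiv]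
  simp only [add_apply, smul_apply, ContinuousLinearMap.comp_apply, innerSL_apply_apply,
    fderivInnerCLM_apply, ContinuousLinearMap.prod_apply, map_sub, map_smul, hDf, smul_eq_mul,
    real_inner_self_eq_norm_sq, nsmul_eq_mul]
  have e1 : inner ℝ (G x) (fderiv ℝ G x (P x)) = inner ℝ (fderiv ℝ G x (G x)) (P x) := by
    rw [real_inner_comm, hsymm]
  have e2 : inner ℝ (G x) (fderiv ℝ G x (G x)) = inner ℝ (fderiv ℝ G x (G x)) (G x) :=
    real_inner_comm _ _
  have e3 : inner ℝ (P x) (G x) = inner ℝ (G x) (P x) := real_inner_comm _ _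
  rw [e1, e2, e3]
  field_simp
  push_cast
  ring

end TangentField

/-! ### The Robin condition along the boundary -/

section BoundaryIdentity

variable {N : ℕ} {Ω : Set (EuclideanSpace ℝ (Fin N))} {p : EuclideanSpace ℝ (Fin N)}
  {ρ u : EuclideanSpace ℝ (Fin N) → ℝ} {β : ℝ}

theorem normalDerivative_eq (hρ : IsDefiningFunctionAt Ω p ρ)
    (hp : p ∈ frontier Ω) :
    normalDerivative Ω u p =
      inner ℝ (gradient ρ p) (gradientWithin u (closure Ω) p) * ‖gradient ρ p‖⁻¹ := by
  rw [normalDerivative, ← inner_gradientWithin_left, outerNormal_eq hp hρ, real_inner_smul_right,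
    real_inner_comm, mul_comm]

theorem contDiffOn_gradientWithin (hΩ : IsOpen Ω) (hC : HasC2Boundary Ω)
    (hu : ContDiffOn ℝ 2 u (closure Ω)) : ContDiffOn ℝ 1 (gradientWithin u (closure Ω)) (closure Ω) :=
  (rieszEquiv _).contDiff.comp_contDiffOn
    (hu.fderivWithin (uniqueDiffOn_closure hΩ hC) (by norm_num))

/-- The Robin condition differentiated along the boundary. -/
theorem robin_tangential_derivative (hΩ : IsOpen Ω) (hC : HasC2Boundary Ω)
    (hρ : ∀ p ∈ frontier Ω, IsDefiningFunctionAt Ω p ρ) (hp : p ∈ frontier Ω)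
    (hu : ContDiffOn ℝ 2 u (closure Ω))
    (hrob : ∀ p ∈ frontier Ω, normalDerivative Ω u p + β * u p = 0)
    {τ : EuclideanSpace ℝ (Fin N)} (hτ : inner ℝ (gradient ρ p) τ = 0) :
    inner ℝ (gradient ρ p) (fderivWithin ℝ (gradientWithin u (closure Ω)) (closure Ω) p τ) +
      inner ℝ (gradientWithin u (closure Ω) p) (fderiv ℝ (gradient ρ) p τ) +
      β * (inner ℝ (gradientWithin u (closure Ω) p) τ * ‖gradient ρ p‖ +
        u p * (‖gradient ρ p‖⁻¹ * inner ℝ (gradient ρ p) (fderiv ℝ (gradient ρ) p τ))) = 0 := by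
  have hpc : p ∈ closure Ω := frontier_subset_closure hp
  have hPd : HasFDerivWithinAt (gradientWithin u (closure Ω)) _ (closure Ω) p :=
    ((contDiffOn_gradientWithin hΩ hC hu).differentiableOn (by norm_num) p hpc).hasFDerivWithinAt
  have hud : HasFDerivWithinAt u _ (closure Ω) p :=
    (hu.differentiableOn (by norm_num) p hpc).hasFDerivWithinAt
  have hGd : HasFDerivAt (gradient ρ) (fderiv ℝ (gradient ρ) p) p :=
    (((rieszEquiv (EuclideanSpace ℝ (Fin N))).contDiff.contDiffAt.comp p
      ((hρ p hp).contDiffAt.fderiv_right (m := 1) (by norm_num))).differentiableAt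
        (by norm_num)).hasFDerivAt
  have hn := (hasFDerivAt_norm_comp hGd (hρ p hp).gradient_ne_zero).hasFDerivWithinAt
    (s := closure Ω)
  have hΦ := (((hGd.hasFDerivWithinAt (s := closure Ω)).inner ℝ hPd).add
    ((hud.mul hn).const_mul β)).mono (frontier_subset_closure (s := Ω))
  have hz : HasFDerivWithinAt (fun x => inner ℝ (gradient ρ x) (gradientWithin u (closure Ω) x) +
      β * (u x * ‖gradient ρ x‖)) (0 : EuclideanSpace ℝ (Fin N) →L[ℝ] ℝ) (frontier Ω) p := by
    have hzero : ∀ x ∈ frontier Ω, inner ℝ (gradient ρ x) (gradientWithin u (closure Ω) x) +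
        β * (u x * ‖gradient ρ x‖) = 0 := by
      intro x hx
      have h := hrob x hx
      have hr : ‖gradient ρ x‖ ≠ 0 := norm_ne_zero_iff.2 (hρ x hx).gradient_ne_zero
      rw [normalDerivative_eq (hρ x hx) hx] at h
      field_simp at h
      linarith
    exact (hasFDerivWithinAt_const (0 : ℝ) p (frontier Ω)).congr hzero (hzero p hp)
  -- The function vanishes only on the boundary, so its derivative is compared with zero only along
  -- `τ`, which lies in the tangent cone.
  have h := hΦ.unique_on hz ((hρ p hp).mem_tangentConeAt hp hτ)
  simp only [add_apply, smul_apply, ContinuousLinearMap.comp_apply, innerSL_apply_apply,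
    fderivInnerCLM_apply, ContinuousLinearMap.prod_apply, smul_eq_mul, zero_apply,
    ← inner_gradientWithin_left] at h
  rw [real_inner_comm (gradientWithin u (closure Ω) p) (fderiv ℝ (gradient ρ) p τ)] at h
  rw [← h]
  ring

end BoundaryIdentity

/-! ### The boundary integrand and `D²u = I` -/

section Rigidity

variable {N : ℕ} {Ω : Set (EuclideanSpace ℝ (Fin N))}
  {ρ u : EuclideanSpace ℝ (Fin N) → ℝ} {β : ℝ}

/-- `minCurvature` bounds the tangential Hessian of a defining function from below. -/
theorem minCurvature_mul_le_hessian {p : EuclideanSpace ℝ (Fin N)}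
    (hρ : IsDefiningFunctionAt Ω p ρ) (hp : p ∈ frontier Ω)
    (hbdd : BddBelow {κ : ℝ | ∃ p ∈ frontier Ω, κ ∈ principalCurvatures Ω p})
    {τ : EuclideanSpace ℝ (Fin N)} (hτ : inner ℝ (gradient ρ p) τ = 0) :
    ‖gradient ρ p‖ * (minCurvature Ω * ‖τ‖ ^ 2) ≤ inner ℝ (fderiv ℝ (gradient ρ) p τ) τ := by
  have hr : 0 < ‖gradient ρ p‖ := norm_pos_iff.2 hρ.gradient_ne_zero
  have hmem : τ ∈ tangentSpaceAt Ω p := by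
    rw [Submodule.mem_orthogonal_singleton_iff_inner_right, outerNormal_eq hp hρ,
      real_inner_smul_left, hτ, mul_zero]
  have h := minCurvature_mul_le hρ hp hbdd ⟨τ, hmem⟩
  rw [inner_shapeOperator hp hρ, ← inner_fderiv_gradient, le_inv_mul_iff₀ hr] at h
  exact h

/-- On the tangential part `τ` of `∇u`, the mixed second derivative `D²u(τ, ∇ρ)` is determined by
the curvature and the Robin condition. -/
theorem hessian_tangential_part {p τ : EuclideanSpace ℝ (Fin N)} (hΩ : IsOpen Ω)
    (hC : HasC2Boundary Ω) (hρ : ∀ p ∈ frontier Ω, IsDefiningFunctionAt Ω p ρ)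
    (hp : p ∈ frontier Ω) (hu : ContDiffOn ℝ 2 u (closure Ω))
    (hrob : ∀ p ∈ frontier Ω, normalDerivative Ω u p + β * u p = 0)
    (hτ : τ = gradientWithin u (closure Ω) p -
      (inner ℝ (gradient ρ p) (gradientWithin u (closure Ω) p) / ‖gradient ρ p‖ ^ 2) •
        gradient ρ p) :
    inner ℝ (gradient ρ p) τ = 0 ∧
    inner ℝ (gradient ρ p) (fderivWithin ℝ (gradientWithin u (closure Ω)) (closure Ω) p τ) =
      -inner ℝ (fderiv ℝ (gradient ρ) p τ) τ - β * (‖τ‖ ^ 2 * ‖gradient ρ p‖) := by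
  have hR := hrob p hp
  have hr : 0 < ‖gradient ρ p‖ := norm_pos_iff.2 (hρ p hp).gradient_ne_zero
  rw [normalDerivative_eq (hρ p hp) hp] at hR
  have hT := fun h => robin_tangential_derivative hΩ hC hρ hp hu hrob (τ := τ) h
  set g := gradient ρ p with hg
  set P := gradientWithin u (closure Ω) p with hP
  set A := fderivWithin ℝ (gradientWithin u (closure Ω)) (closure Ω) p with hA
  set H := fderiv ℝ (gradient ρ) p with hH
  set r := ‖g‖ with hrdef
  set b := inner ℝ g P with hb
  have hgτ : inner ℝ g τ = 0 := by
    rw [hτ, inner_sub_right, real_inner_smul_right, real_inner_self_eq_norm_sq, ← hrdef,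
      div_mul_cancel₀ _ (by positivity), ← hb, sub_self]
  replace hT := hT hgτ
  have hPτ : P = τ + (b / r ^ 2) • g := by rw [hτ]; abel
  have hPτ2 : inner ℝ P τ = ‖τ‖ ^ 2 := by
    conv_lhs => rw [hPτ]
    rw [inner_add_left, real_inner_smul_left, hgτ, real_inner_self_eq_norm_sq]; ring
  have hPH : inner ℝ P (H τ) = inner ℝ (H τ) τ + b / r ^ 2 * inner ℝ g (H τ) := by
    conv_lhs => rw [hPτ]
    rw [inner_add_left, real_inner_smul_left, real_inner_comm]
  have hbu : β * u p = -(b * r⁻¹) := by linarith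
  refine ⟨hgτ, ?_⟩
  rw [hPH, hPτ2] at hT
  have e : β * (‖τ‖ ^ 2 * r + u p * (r⁻¹ * inner ℝ g (H τ))) =
      β * (‖τ‖ ^ 2 * r) + β * u p * (r⁻¹ * inner ℝ g (H τ)) := by ring
  rw [e, hbu] at hT
  -- The Robin condition cancels the mixed term `⟨∇ρ, Hτ⟩`, which depends on the choice of `ρ`.
  have e2 : b / r ^ 2 * inner ℝ g (H τ) + -(b * r⁻¹) * (r⁻¹ * inner ℝ g (H τ)) = 0 := by
    field_simp; ring
  linarith

/-- After splitting `∇u` into normal and tangential parts, the terms in `D²u(∇ρ, ∇ρ)` cancel, and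
`u_ν 𝓜 = 1` makes the terms linear in `u_ν` cancel as well. What remains is `⟨Hτ, τ⟩ + 2β |∇ρ|
|τ|²`, with `H` the Hessian of `ρ`. -/
theorem boundary_integrand_nonneg {p : EuclideanSpace ℝ (Fin N)} (hN : 2 ≤ N) (hΩ : IsOpen Ω)
    (hC : HasC2Boundary Ω) (hρ : ∀ p ∈ frontier Ω, IsDefiningFunctionAt Ω p ρ)
    (hbdd : BddBelow {κ : ℝ | ∃ p ∈ frontier Ω, κ ∈ principalCurvatures Ω p})
    (hp : p ∈ frontier Ω) (hu : ContDiffOn ℝ 2 u (closure Ω))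
    (hrob : ∀ p ∈ frontier Ω, normalDerivative Ω u p + β * u p = 0)
    (hcurv : normalDerivative Ω u p * meanCurvature Ω p = 1)
    (hκ : 0 < minCurvature Ω + 2 * β) :
    0 ≤ inner ℝ (gradient ρ p) (gradientWithin u (closure Ω) p -
        fderivWithin ℝ (gradientWithin u (closure Ω)) (closure Ω) p
          (gradientWithin u (closure Ω) p)) +
      (β * (‖gradient ρ p‖ * ‖gradientWithin u (closure Ω) p‖ ^ 2 -
          inner ℝ (gradient ρ p) (gradientWithin u (closure Ω) p) ^ 2 * ‖gradient ρ p‖⁻¹) +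
        β * u p * ‖gradient ρ p‖⁻¹ *
        (‖gradient ρ p‖ ^ 2 * N - inner ℝ (gradient ρ p)
          (fderivWithin ℝ (gradientWithin u (closure Ω)) (closure Ω) p (gradient ρ p)) -
          inner ℝ (gradient ρ p) (gradientWithin u (closure Ω) p) *
            (divergence (gradient ρ) p - inner ℝ (fderiv ℝ (gradient ρ) p (gradient ρ p))
              (gradient ρ p) / ‖gradient ρ p‖ ^ 2))) := by
  have hM := meanCurvature_eq hN (hρ p hp) hp
  have hR := hrob p hp
  have hr : 0 < ‖gradient ρ p‖ := norm_pos_iff.2 (hρ p hp).gradient_ne_zero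
  rw [normalDerivative_eq (hρ p hp) hp] at hcurv hR
  rw [← hM]
  clear hM
  obtain ⟨hgτ, hAτ⟩ := hessian_tangential_part hΩ hC hρ hp hu hrob rfl
  set g := gradient ρ p with hg
  set P := gradientWithin u (closure Ω) p with hP
  set A := fderivWithin ℝ (gradientWithin u (closure Ω)) (closure Ω) p with hA
  set H := fderiv ℝ (gradient ρ) p with hH
  set r := ‖g‖ with hrdef
  set b := inner ℝ g P with hb
  set τ := P - (b / r ^ 2) • g with hτdef
  have hK := minCurvature_mul_le_hessian (hρ p hp) hp hbdd hgτ
  rw [← hg, ← hH] at hK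
  have hPτ : P = τ + (b / r ^ 2) • g := by rw [hτdef]; abel
  have hPn : ‖P‖ ^ 2 = ‖τ‖ ^ 2 + b ^ 2 / r ^ 2 := by
    rw [hPτ, norm_add_sq_real, real_inner_smul_right, real_inner_comm, hgτ, norm_smul, mul_pow,
      Real.norm_eq_abs, sq_abs, ← hrdef]
    field_simp
    ring
  have hAP : inner ℝ g (A P) = inner ℝ g (A τ) + b / r ^ 2 * inner ℝ g (A g) := by
    conv_lhs => rw [hPτ]
    rw [map_add, map_smul, inner_add_right, real_inner_smul_right]
  have hbu : β * u p = -(b * r⁻¹) := by linarith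
  have hbM : b * (((N : ℝ) - 1) * meanCurvature Ω p * r) = ((N : ℝ) - 1) * r ^ 2 := by
    have : b * meanCurvature Ω p = r := by field_simp at hcurv; exact hcurv
    calc b * (((N : ℝ) - 1) * meanCurvature Ω p * r)
        = ((N : ℝ) - 1) * r * (b * meanCurvature Ω p) := by ring
      _ = _ := by rw [this]; ring
  rw [inner_sub_right, ← hb, hAP, hAτ, hPn, hbM, hbu]
  have hfin : b - (-inner ℝ (H τ) τ - β * (‖τ‖ ^ 2 * r) + b / r ^ 2 * inner ℝ g (A g)) +
      (β * (r * (‖τ‖ ^ 2 + b ^ 2 / r ^ 2) - b ^ 2 * r⁻¹) +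
        -(b * r⁻¹) * r⁻¹ * (r ^ 2 * N - inner ℝ g (A g) - ((N : ℝ) - 1) * r ^ 2)) =
      inner ℝ (H τ) τ + 2 * β * (r * ‖τ‖ ^ 2) := by
    field_simp; ring
  rw [hfin]
  have h0 : 0 ≤ (minCurvature Ω + 2 * β) * (r * ‖τ‖ ^ 2) := by positivity
  linarith

theorem gradientWithin_eventuallyEq {x : EuclideanSpace ℝ (Fin N)} (hΩ : IsOpen Ω) (hx : x ∈ Ω) :
    gradientWithin u (closure Ω) =ᶠ[𝓝 x] gradient u := by
  filter_upwards [hΩ.mem_nhds hx] with y hy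
  rw [gradientWithin, gradient, fderivWithin_of_mem_nhds
    (mem_of_superset (hΩ.mem_nhds hy) subset_closure)]

theorem divergence_gradient {x : EuclideanSpace ℝ (Fin N)} :
    divergence (gradient u) x = Laplacian.laplacian u x := by
  rw [laplacian_eq_iteratedFDeriv_orthonormalBasis u (EuclideanSpace.basisFun (Fin N) ℝ),
    divergence, LinearMap.trace_eq_sum_inner _ (EuclideanSpace.basisFun (Fin N) ℝ)]
  refine Finset.sum_congr rfl fun i _ => ?_
  rw [iteratedFDeriv_two_apply, real_inner_comm]
  exact inner_fderiv_gradient _ _ _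

/-- `trace_sq_eq_of_boundary_nonneg` is applied to `P = ∇u` with `X` built from `f = β u`, a regular
extension of `-u_ν` from the boundary into `Ω`. Equality of traces then makes `|D²u - I|²` vanish.
-/
theorem fderiv_gradient_eq_id (hN : 2 ≤ N) (hΩ : IsOpen Ω) (hb : Bornology.IsBounded Ω)
    (hC : HasC2Boundary Ω) (hu : IsRobinTorsionSolution Ω β u)
    (hcurv : ∀ p ∈ frontier Ω, normalDerivative Ω u p * meanCurvature Ω p = 1)
    (hκ : 0 < minCurvature Ω + 2 * β) :
    ∀ x ∈ Ω, fderiv ℝ (gradientWithin u (closure Ω)) x = ContinuousLinearMap.id ℝ _ := by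
  obtain ⟨ρ, hρ, hρΩ, hρg⟩ := exists_global_definingFunction hΩ hb hC
  have hdef : ∀ p ∈ frontier Ω, IsDefiningFunctionAt Ω p ρ := fun p hp =>
    ⟨hρ.contDiffAt, hρg p hp, Eventually.of_forall hρΩ⟩
  have hbdd := bddBelow_principalCurvatures hb hρ hdef
  have hUD := uniqueDiffOn_closure hΩ hC
  set P := gradientWithin u (closure Ω) with hPdef
  set A := fderivWithin ℝ P (closure Ω) with hAdef
  have hPc := contDiffOn_gradientWithin hΩ hC hu.contDiffOn
  have hP1 : ContDiffOn ℝ 1 P Ω := hPc.mono subset_closure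
  have hnhd : ∀ x ∈ Ω, closure Ω ∈ 𝓝 x := fun x hx =>
    mem_of_superset (hΩ.mem_nhds hx) subset_closure
  have hAeq : ∀ x ∈ Ω, fderiv ℝ P x = A x := fun x hx =>
    (fderivWithin_of_mem_nhds (hnhd x hx)).symm
  have hAg : ∀ x ∈ Ω, fderiv ℝ P x = fderiv ℝ (gradient u) x := fun x hx =>
    (gradientWithin_eventuallyEq hΩ hx).fderiv_eq
  have hdiv : ∀ x ∈ Ω, divergence P x = N := by
    intro x hx
    rw [← hu.laplacian_eq x hx, ← divergence_gradient, divergence, divergence, hAg x hx]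
  have hsymm : ∀ x ∈ Ω, ∀ v w, inner ℝ (fderiv ℝ P x v) w = inner ℝ (fderiv ℝ P x w) v := by
    intro x hx v w
    rw [hAg x hx]
    exact inner_fderiv_gradient_comm (hu.contDiffOn.contDiffAt (hnhd x hx)) v w
  have hsq : ∀ x ∈ Ω, LinearMap.trace ℝ _ (fderiv ℝ P x ∘L fderiv ℝ P x).toLinearMap - N =
      ∑ i, ‖fderiv ℝ P x (EuclideanSpace.basisFun (Fin N) ℝ i) -
        EuclideanSpace.basisFun (Fin N) ℝ i‖ ^ 2 := by
    intro x hx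
    rw [← trace_sq_sub_two_mul_trace _ _ (hsymm x hx)]
    have := hdiv x hx
    rw [divergence] at this
    rw [this, Fintype.card_fin]
    ring
  have hG : ContDiff ℝ 1 (gradient ρ) :=
    (rieszEquiv _).contDiff.comp (hρ.fderiv_right (m := 1) (by norm_num))
  have hGc := hG.continuous
  have hG0 : ∀ p ∈ frontier Ω, ∀ᶠ x in 𝓝[closure Ω] p, gradient ρ x ≠ 0 := fun p hp =>
    nhdsWithin_le_nhds (hGc.continuousAt.eventually_ne (hρg p hp))
  obtain ⟨ε₁, hε₁, hlayer⟩ := exists_layer_of_eventually hb hρ.continuous hρΩ hG0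
  set U := Ω ∩ {x | gradient ρ x ≠ 0} with hUdef
  have hUo : IsOpen U := hΩ.inter (isOpen_ne_fun hGc continuous_const)
  have hX : ContDiffOn ℝ 1 (tangentField (fun y => β * u y) P (gradient ρ)) U := by
    intro x hx
    have h1 : ContDiffAt ℝ 1 P x := hP1.contDiffAt (hΩ.mem_nhds hx.1)
    have h2 : ContDiffAt ℝ 1 u x := (hu.contDiffOn.contDiffAt (hnhd x hx.1)).of_le (by norm_num)
    have h3 : ContDiffAt ℝ 1 (gradient ρ) x := hG.contDiffAt
    exact ContDiffAt.contDiffWithinAt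
      (((contDiffAt_const.mul h2).mul ((h3.norm ℝ hx.2).inv (norm_ne_zero_iff.2 hx.2))).smul
        (((h3.norm_sq ℝ).smul h1).sub ((h3.inner ℝ h1).smul h3)))
  have htrace := trace_sq_eq_of_boundary_nonneg hb hρ hρΩ hP1 hdiv
    (fun x hx => by
      have := hsq x hx
      have h2 : 0 ≤ ∑ i, ‖fderiv ℝ P x (EuclideanSpace.basisFun (Fin N) ℝ i) -
        EuclideanSpace.basisFun (Fin N) ℝ i‖ ^ 2 := Finset.sum_nonneg fun i _ => by positivity
      linarith) hUo hX hε₁ (fun x hx hxε => ⟨hx, hlayer x hx hxε⟩)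
    (fun x _ => inner_tangentField _ _ _ _) ?_
  · intro x hx
    have h1 := hsq x hx
    rw [htrace x hx, sub_self, eq_comm,
      Finset.sum_eq_zero_iff_of_nonneg fun i _ => by positivity] at h1
    refine ContinuousLinearMap.coe_injective
      ((EuclideanSpace.basisFun (Fin N) ℝ).toBasis.ext fun i => ?_)
    have := h1 i (Finset.mem_univ i)
    rw [sq_eq_zero_iff, norm_eq_zero, sub_eq_zero] at this
    simpa using this
  · intro δ hδ
    -- `q` is the integrand written with derivatives within the closure, hence continuous up to the
    -- boundary. Being nonnegative there, it exceeds `-δ |∇ρ|²` in a layer.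
    set q : EuclideanSpace ℝ (Fin N) → ℝ := fun x =>
      inner ℝ (gradient ρ x) (P x - A x (P x)) +
      (β * (‖gradient ρ x‖ * ‖P x‖ ^ 2 - inner ℝ (gradient ρ x) (P x) ^ 2 * ‖gradient ρ x‖⁻¹) +
        β * u x * ‖gradient ρ x‖⁻¹ *
        (‖gradient ρ x‖ ^ 2 * N - inner ℝ (gradient ρ x) (A x (gradient ρ x)) -
          inner ℝ (gradient ρ x) (P x) * (divergence (gradient ρ) x -
            inner ℝ (fderiv ℝ (gradient ρ) x (gradient ρ x)) (gradient ρ x) /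
              ‖gradient ρ x‖ ^ 2))) with hqdef
    have hq : ∀ p ∈ frontier Ω, ∀ᶠ x in 𝓝[closure Ω] p,
        gradient ρ x ≠ 0 ∧ -δ * ‖gradient ρ x‖ ^ 2 ≤ q x := by
      intro p hp
      have hpc := frontier_subset_closure hp
      have hr : ‖gradient ρ p‖ ≠ 0 := norm_ne_zero_iff.2 (hρg p hp)
      have cP : ContinuousWithinAt P (closure Ω) p := hPc.continuousOn p hpc
      have cA : ContinuousWithinAt A (closure Ω) p :=
        (hPc.continuousOn_fderivWithin hUD (by norm_num)) p hpc
      have cu : ContinuousWithinAt u (closure Ω) p := hu.contDiffOn.continuousOn p hpc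
      have cG : ContinuousWithinAt (gradient ρ) (closure Ω) p := hGc.continuousWithinAt
      have cH : ContinuousWithinAt (fderiv ℝ (gradient ρ)) (closure Ω) p :=
        (hG.continuous_fderiv (by norm_num)).continuousWithinAt
      have cdiv : ContinuousWithinAt (divergence (gradient ρ)) (closure Ω) p :=
        (continuous_trace_toLinearMap.comp (hG.continuous_fderiv
          (by norm_num))).continuousWithinAt
      have cinv := cG.norm.inv₀ hr
      have cGP : ContinuousWithinAt (fun x => inner ℝ (gradient ρ x) (P x)) (closure Ω) p :=
        cG.inner cP
      have cq : ContinuousWithinAt q (closure Ω) p :=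
        (cG.inner (cP.sub (cA.clm_apply cP))).add
          ((continuousWithinAt_const.mul ((cG.norm.mul (cP.norm.pow 2)).sub
            ((cGP.pow 2).mul cinv))).add
          (((continuousWithinAt_const.mul cu).mul cinv).mul
            ((((cG.norm.pow 2).mul continuousWithinAt_const).sub (cG.inner (cA.clm_apply cG))).sub
              (cGP.mul (cdiv.sub (((cH.clm_apply cG).inner cG).div (cG.norm.pow 2)
                (pow_ne_zero 2 hr)))))))
      have hq0 : 0 ≤ q p := boundary_integrand_nonneg hN hΩ hC hdef hbdd hp hu.contDiffOn hu.robin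
        (hcurv p hp) hκ
      have hlt : -δ * ‖gradient ρ p‖ ^ 2 < q p := by
        have : 0 < δ * ‖gradient ρ p‖ ^ 2 := by positivity
        linarith
      filter_upwards [hG0 p hp, (continuousWithinAt_const.mul (cG.norm.pow 2)).eventually_lt cq hlt]
        with x h1 h2 using ⟨h1, h2.le⟩
    obtain ⟨ε, hε, h⟩ := exists_layer_of_eventually hb hρ.continuous hρΩ hq
    refine ⟨ε, hε, fun x hx hxε => ?_⟩
    obtain ⟨h1, h2⟩ := h x hx hxε
    have hud : DifferentiableAt ℝ u x :=
      (hu.contDiffOn.contDiffAt (hnhd x hx)).differentiableAt (by norm_num)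
    have hPd : DifferentiableAt ℝ P x :=
      (hP1.contDiffAt (hΩ.mem_nhds hx)).differentiableAt (by norm_num)
    rw [divergence_tangentField (β := β) (hud.const_mul β) hPd
      (hG.differentiable (by norm_num) x) h1 (fun v => ?_)
      (inner_fderiv_gradient_comm hρ.contDiffAt), hdiv x hx, hAeq x hx]
    · exact h2
    · rw [fderiv_const_mul hud, smul_apply, smul_eq_mul, hPdef, inner_gradientWithin_left,
        fderivWithin_of_mem_nhds (hnhd x hx)]

/-- The solution is a paraboloid. -/
theorem exists_eq_paraboloid (hN : 2 ≤ N) (hΩ : IsOpen Ω) (hconn : IsConnected Ω)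
    (hb : Bornology.IsBounded Ω)
    (hC : HasC2Boundary Ω) (hu : IsRobinTorsionSolution Ω β u)
    (hcurv : ∀ p ∈ frontier Ω, normalDerivative Ω u p * meanCurvature Ω p = 1)
    (hκ : 0 < minCurvature Ω + 2 * β) :
    ∃ (z : EuclideanSpace ℝ (Fin N)) (c : ℝ),
      (∀ x ∈ closure Ω, gradientWithin u (closure Ω) x = x - z) ∧
      ∀ x ∈ closure Ω, u x = ‖x - z‖ ^ 2 / 2 + c := by
  have hid := fderiv_gradient_eq_id hN hΩ hb hC hu hcurv hκ
  have hPc := contDiffOn_gradientWithin hΩ hC hu.contDiffOn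
  set P := gradientWithin u (closure Ω) with hPdef
  have hnhd : ∀ x ∈ Ω, closure Ω ∈ 𝓝 x := fun x hx =>
    mem_of_superset (hΩ.mem_nhds hx) subset_closure
  have hPd : ∀ x ∈ Ω, DifferentiableAt ℝ P x := fun x hx =>
    (hPc.contDiffAt (hnhd x hx)).differentiableAt (by norm_num)
  obtain ⟨w, hw⟩ : ∃ w, ∀ x ∈ Ω, P x - x = w := by
    refine hΩ.exists_is_const_of_fderiv_eq_zero hconn.isPreconnected
      (f := fun x => P x - x) (𝕜 := ℝ)
      (fun x hx => ((hPd x hx).sub differentiableAt_id).differentiableWithinAt) fun x hx => ?_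
    rw [fderiv_fun_sub (hPd x hx) differentiableAt_fun_id, hid x hx, fderiv_fun_id, sub_self]
    rfl
  have hPΩ : ∀ x ∈ Ω, P x = x - -w := by
    intro x hx
    rw [← hw x hx]; abel
  have hPcl : EqOn P (fun x => x - -w) (closure Ω) :=
    EqOn.of_subset_closure (fun x hx => hPΩ x hx) hPc.continuousOn (by fun_prop) subset_closure
      subset_rfl
  obtain ⟨c, hc⟩ : ∃ c, ∀ x ∈ Ω, u x - ‖x - -w‖ ^ 2 / 2 = c := by
    have hud : ∀ x ∈ Ω, HasFDerivAt u (fderiv ℝ u x) x := fun x hx =>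
      ((hu.contDiffOn.contDiffAt (hnhd x hx)).differentiableAt (by norm_num)).hasFDerivAt
    have hnd : ∀ x, HasFDerivAt (fun x => ‖x - -w‖ ^ 2 / 2) (innerSL ℝ (x - -w)) x := by
      intro x
      have h := (((hasFDerivAt_id x).sub_const (-w)).norm_sq).const_mul (2⁻¹ : ℝ)
      refine (h.congr_of_eventuallyEq (Eventually.of_forall fun y => ?_)).congr_fderiv ?_
      · simp only [id]; ring
      · ext v; simp
    refine hΩ.exists_is_const_of_fderiv_eq_zero hconn.isPreconnected
      (f := fun x => u x - ‖x - -w‖ ^ 2 / 2) (𝕜 := ℝ)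
      (fun x hx => ((hud x hx).sub (hnd x)).differentiableAt.differentiableWithinAt) fun x hx => ?_
    refine ((hud x hx).sub (hnd x)).fderiv.trans ?_
    ext v
    have h1 : inner ℝ (P x) v = fderivWithin ℝ u (closure Ω) x v := inner_gradientWithin_left
    rw [fderivWithin_of_mem_nhds (hnhd x hx), hPΩ x hx] at h1
    simp only [sub_apply, innerSL_apply_apply, h1, sub_self, Pi.zero_apply, zero_apply]
  refine ⟨-w, c, hPcl, ?_⟩
  exact EqOn.of_subset_closure (s := Ω) (fun x hx => by
      have := hc x hx
      change u x = ‖x - -w‖ ^ 2 / 2 + c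
      linarith)
    hu.contDiffOn.continuousOn (by fun_prop) subset_closure subset_rfl

end Rigidity

/-! ### Domains whose boundary lies on a sphere -/

section Balls

variable {E : Type*} [NormedAddCommGroup E] [NormedSpace ℝ E] [Nontrivial E]
  {Ω : Set E} {z : E} {R : ℝ}

/-- The point of the closure farthest from `z` cannot be interior, so the largest distance is
attained on the boundary. -/
theorem subset_ball_of_frontier_subset [FiniteDimensional ℝ E] (hΩ : IsOpen Ω)
    (hb : Bornology.IsBounded Ω) (hf : frontier Ω ⊆ Metric.closedBall z R) :
    Ω ⊆ Metric.ball z R := by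
  rw [← interior_closedBall' z R]
  refine hΩ.subset_interior_iff.2 ?_
  rcases Ω.eq_empty_or_nonempty with rfl | hne
  · exact empty_subset _
  have hcl : IsCompact (closure Ω) := hb.isCompact_closure
  obtain ⟨y, hy, hmax⟩ := hcl.exists_isMaxOn hne.closure
    (Continuous.continuousOn (f := fun x => dist x z) (by fun_prop))
  have hsub : Ω ⊆ Metric.closedBall z (dist y z) := fun x hx => hmax (subset_closure hx)
  have hyf : y ∈ frontier Ω := by
    refine ⟨hy, fun hyi => ?_⟩
    have := interior_mono hsub hyi
    rw [interior_closedBall', Metric.mem_ball] at this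
    exact lt_irrefl _ this
  exact fun x hx => Metric.mem_closedBall.2
    ((Metric.mem_closedBall.1 (hsub hx)).trans (Metric.mem_closedBall.1 (hf hyf)))

/-- The ball is connected and does not meet the boundary of `Ω`, so it lies entirely in `Ω` once it
contains one of its points. -/
theorem eq_ball_of_frontier_subset_sphere [FiniteDimensional ℝ E] (hΩ : IsOpen Ω)
    (hne : Ω.Nonempty) (hb : Bornology.IsBounded Ω) (hf : frontier Ω ⊆ Metric.sphere z R) :
    0 < R ∧ Ω = Metric.ball z R := by
  have hsub := subset_ball_of_frontier_subset hΩ hb (hf.trans Metric.sphere_subset_closedBall)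
  obtain ⟨x, hx⟩ := hne
  refine ⟨Metric.nonempty_ball.1 ⟨x, hsub hx⟩, hsub.antisymm ?_⟩
  refine (convex_ball z R).isPreconnected.subset_left_of_subset_union hΩ
    isClosed_closure.isOpen_compl (disjoint_compl_right_iff_subset.2 subset_closure)
    (fun y hy => ?_) ⟨x, hsub hx, hx⟩
  by_contra h
  rw [mem_union, not_or, mem_compl_iff, not_not] at h
  have hyf : y ∈ frontier Ω := ⟨h.2, by rw [hΩ.interior_eq]; exact h.1⟩
  exact (Metric.mem_ball.1 hy).ne (Metric.mem_sphere.1 (hf hyf))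

theorem nonempty_frontier_of_isBounded (hne : Ω.Nonempty) (hb : Bornology.IsBounded Ω) :
    (frontier Ω).Nonempty :=
  nonempty_frontier_iff.2 ⟨hne, fun h => NormedSpace.unbounded_univ ℝ E (h ▸ hb)⟩

end Balls

/-! ### The boundary is a sphere around the centre of the paraboloid -/

section Sphere

variable {N : ℕ} {Ω : Set (EuclideanSpace ℝ (Fin N))}
  {u : EuclideanSpace ℝ (Fin N) → ℝ} {β : ℝ}

/-- At a boundary point of `Ω` on the sphere around `z` through it, with `Ω` inside the ball, the
normal is radial. -/
theorem IsDefiningFunctionAt.inner_eq_of_subset_closedBall {p z : EuclideanSpace ℝ (Fin N)}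
    {ρ : EuclideanSpace ℝ (Fin N) → ℝ} (hρ : IsDefiningFunctionAt Ω p ρ) (hp : p ∈ frontier Ω)
    (hsub : Ω ⊆ Metric.closedBall z (dist p z)) :
    inner ℝ (gradient ρ p) (p - z) = ‖gradient ρ p‖ * ‖p - z‖ := by
  refine (real_inner_le_norm _ _).antisymm (not_lt.1 fun hlt => ?_)
  set g := gradient ρ p with hg
  set P := p - z with hP
  -- If `g` and `P` were not parallel, this direction would enter `Ω` while leaving the ball.
  set w := ‖g‖ • P - ‖P‖ • g with hw
  have hg0 : 0 < ‖g‖ := norm_pos_iff.2 hρ.gradient_ne_zero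
  have hP0 : 0 < ‖P‖ := by
    refine norm_pos_iff.2 fun h => ?_
    rw [h] at hlt
    simp at hlt
  have h1 : inner ℝ g w < 0 := by
    rw [hw, inner_sub_right, real_inner_smul_right, real_inner_smul_right,
      real_inner_self_eq_norm_sq]
    nlinarith
  have h2 : 0 < inner ℝ P w := by
    rw [hw, inner_sub_right, real_inner_smul_right, real_inner_smul_right,
      real_inner_self_eq_norm_sq, real_inner_comm]
    nlinarith
  obtain ⟨t, ht, ht0⟩ := (((hρ.ray_mem hp w).1 h1).and self_mem_nhdsWithin).exists
  have ht0' : 0 < t := ht0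
  have h3 := hsub ht
  rw [Metric.mem_closedBall, dist_eq_norm, dist_eq_norm] at h3
  have h4 : p + t • w - z = P + t • w := by rw [hP]; abel
  rw [h4, ← hP] at h3
  have h5 : ‖P + t • w‖ ^ 2 ≤ ‖P‖ ^ 2 := pow_le_pow_left₀ (norm_nonneg _) h3 2
  rw [norm_add_sq_real, real_inner_smul_right] at h5
  have h6 := mul_pos ht0' h2
  have h7 := sq_nonneg ‖t • w‖
  linarith

/-- On the boundary `u_ν = -β (|x - z|²/2 + c)`, so a second relation between `u_ν` and `|x - z|` is
needed. The sign of `β` decides whether it comes from curvature or from a farthest point. -/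
theorem exists_frontier_subset_sphere (hN : 2 ≤ N) (hΩ : IsOpen Ω) (hconn : IsConnected Ω)
    (hb : Bornology.IsBounded Ω) (hC : HasC2Boundary Ω) (hu : IsRobinTorsionSolution Ω β u)
    (hβ : β ≠ 0) (hcurv : ∀ p ∈ frontier Ω, normalDerivative Ω u p * meanCurvature Ω p = 1)
    (hκ : 0 < minCurvature Ω + 2 * β) {z : EuclideanSpace ℝ (Fin N)} {c : ℝ}
    (hgrad : ∀ x ∈ closure Ω, gradientWithin u (closure Ω) x = x - z)
    (huz : ∀ x ∈ closure Ω, u x = ‖x - z‖ ^ 2 / 2 + c) :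
    ∃ R, frontier Ω ⊆ Metric.sphere z R := by
  have : Nonempty (Fin N) := ⟨⟨0, by omega⟩⟩
  have hΓne : (frontier Ω).Nonempty := nonempty_frontier_of_isBounded hconn.nonempty hb
  have hΓ : IsCompact (frontier Ω) :=
    hb.isCompact_closure.of_isClosed_subset isClosed_frontier frontier_subset_closure
  obtain ⟨ρ, hρ, hρΩ, hρg⟩ := exists_global_definingFunction hΩ hb hC
  have hdef : ∀ p ∈ frontier Ω, IsDefiningFunctionAt Ω p ρ := fun p hp =>
    ⟨hρ.contDiffAt, hρg p hp, Eventually.of_forall hρΩ⟩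
  have hnd : ∀ p ∈ frontier Ω, normalDerivative Ω u p =
      inner ℝ (gradient ρ p) (p - z) * ‖gradient ρ p‖⁻¹ := fun p hp => by
    rw [normalDerivative_eq (hdef p hp) hp, hgrad p (frontier_subset_closure hp)]
  have hrob : ∀ p ∈ frontier Ω, normalDerivative Ω u p = -β * (‖p - z‖ ^ 2 / 2 + c) := by
    intro p hp
    have := hu.robin p hp
    rw [huz p (frontier_subset_closure hp)] at this
    linarith
  have hg0 : ∀ p ∈ frontier Ω, 0 < ‖gradient ρ p‖ := fun p hp => norm_pos_iff.2 (hρg p hp)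
  rcases hβ.lt_or_gt with hneg | hpos
  · have hbdd := bddBelow_principalCurvatures hb hρ hdef
    have hrad : ∀ p ∈ frontier Ω, normalDerivative Ω u p = ‖p - z‖ := by
      intro p hp
      obtain ⟨hgτ, hA⟩ := hessian_tangential_part hΩ hC hdef hp hu.contDiffOn hu.robin rfl
      have hK := minCurvature_mul_le_hessian (hdef p hp) hp hbdd hgτ
      have hAid : fderivWithin ℝ (gradientWithin u (closure Ω)) (closure Ω) p =
          ContinuousLinearMap.id ℝ _ := by
        have hpc := frontier_subset_closure hp
        rw [fderivWithin_congr hgrad (hgrad p hpc)]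
        exact ((hasFDerivWithinAt_id p _).sub_const z).fderivWithin
          (uniqueDiffOn_closure hΩ hC p hpc)
      rw [hAid, ContinuousLinearMap.id_apply, hgτ] at hA
      set τ := gradientWithin u (closure Ω) p -
        (inner ℝ (gradient ρ p) (gradientWithin u (closure Ω) p) / ‖gradient ρ p‖ ^ 2) •
          gradient ρ p with hτ
      -- With `D²u = I` the mixed derivative is zero, so `⟨Hτ, τ⟩ = -β |∇ρ| |τ|²`. As `β < 0`,
      -- `κ_min + β > -β > 0`, which excludes `τ ≠ 0`.
      have hτ0 : τ = 0 := by
        by_contra hne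
        have h1 : 0 < ‖gradient ρ p‖ * ‖τ‖ ^ 2 := by
          have := hg0 p hp
          have := norm_pos_iff.2 hne
          positivity
        have h2 : 0 < (minCurvature Ω + β) * (‖gradient ρ p‖ * ‖τ‖ ^ 2) :=
          mul_pos (by linarith) h1
        linarith
      rw [hgrad p (frontier_subset_closure hp)] at hτ
      have hpar : p - z = (inner ℝ (gradient ρ p) (p - z) / ‖gradient ρ p‖ ^ 2) •
          gradient ρ p := by
        rw [← sub_eq_zero, ← hτ, hτ0]
      have hnorm : ‖p - z‖ = |normalDerivative Ω u p| := by
        conv_lhs => rw [hpar]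
        have := (hg0 p hp).ne'
        rw [norm_smul, Real.norm_eq_abs, hnd p hp, abs_mul, abs_div, abs_inv, abs_norm, abs_pow,
          abs_norm]
        field_simp
      have hM := minCurvature_le_meanCurvature hN (hdef p hp) hp hbdd
      have hM0 : 0 < meanCurvature Ω p := by linarith
      have hn0 : 0 < normalDerivative Ω u p := by
        refine pos_of_mul_pos_left ?_ hM0.le
        rw [hcurv p hp]
        exact one_pos
      rw [hnorm, abs_of_pos hn0]
    -- Here `|p - z| 𝓜 = 1` and `𝓜 ≥ κ_min > -2β`. The bound excludes the second factor in `hfac`,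
    -- which would need `-β` times the sum of two such distances to be 2.
    have hsmall : ∀ p ∈ frontier Ω, -β * ‖p - z‖ * 2 < 1 := by
      intro p hp
      have hM := minCurvature_le_meanCurvature hN (hdef p hp) hp hbdd
      have h1 := hcurv p hp
      rw [hrad p hp] at h1
      have h2 : 0 < ‖p - z‖ := by
        refine (norm_nonneg _).lt_of_ne fun h => ?_
        rw [← h, zero_mul] at h1
        exact zero_ne_one h1
      have h3 : -β * 2 < meanCurvature Ω p := by linarith
      have := mul_lt_mul_of_pos_left h3 h2
      linarith
    obtain ⟨p₀, hp₀⟩ := hΓne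
    refine ⟨‖p₀ - z‖, fun p hp => ?_⟩
    rw [mem_sphere_iff_norm]
    have e0 := (hrad p₀ hp₀).symm.trans (hrob p₀ hp₀)
    have e1 := (hrad p hp).symm.trans (hrob p hp)
    have s0 := hsmall p₀ hp₀
    have s1 := hsmall p hp
    have hfac : (‖p - z‖ - ‖p₀ - z‖) * (2 - -β * (‖p - z‖ + ‖p₀ - z‖)) = 0 := by
      linear_combination 2 * e1 - 2 * e0
    rcases mul_eq_zero.1 hfac with h | h
    · linarith
    · linarith
  -- At the farthest point the normal is radial and `u_ν = |p₀ - z|`; elsewhere `u_ν ≤ |p - z|`. For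
  -- `β > 0` the Robin condition makes `u_ν` decrease with the distance, so no boundary point can be
  -- closer.
  · obtain ⟨p₀, hp₀, hmax⟩ := hΓ.exists_isMaxOn hΓne
      (Continuous.continuousOn (f := fun x => dist x z) (by fun_prop))
    have hsub : Ω ⊆ Metric.closedBall z (dist p₀ z) :=
      (subset_ball_of_frontier_subset hΩ hb fun x hx => hmax hx).trans Metric.ball_subset_closedBall
    refine ⟨‖p₀ - z‖, fun p hp => ?_⟩
    rw [mem_sphere_iff_norm]
    have e0 : normalDerivative Ω u p₀ = ‖p₀ - z‖ := by
      rw [hnd p₀ hp₀, (hdef p₀ hp₀).inner_eq_of_subset_closedBall hp₀ hsub, mul_comm,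
        inv_mul_cancel_left₀ (hg0 p₀ hp₀).ne']
    have e1 : normalDerivative Ω u p ≤ ‖p - z‖ := by
      rw [hnd p hp, ← div_eq_mul_inv, div_le_iff₀ (hg0 p hp), mul_comm]
      exact real_inner_le_norm _ _
    have hle : ‖p - z‖ ≤ ‖p₀ - z‖ := by
      have := hmax hp
      change dist p z ≤ dist p₀ z at this
      rwa [dist_eq_norm, dist_eq_norm] at this
    rw [hrob p₀ hp₀] at e0
    rw [hrob p hp] at e1
    have h1 : β * (‖p₀ - z‖ ^ 2 - ‖p - z‖ ^ 2) ≤ 0 := by linarith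
    have h2 : ‖p₀ - z‖ ^ 2 ≤ ‖p - z‖ ^ 2 := by
      have := nonpos_of_mul_nonpos_right h1 hpos
      linarith
    exact hle.antisymm (le_of_sq_le_sq h2 (norm_nonneg _))

end Sphere

end RobinTorsion

end

open RobinTorsion in
theorem mainTheorem6 {N : ℕ} (hN : 2 ≤ N) (Ω : Set (EuclideanSpace ℝ (Fin N)))
    (hΩ_open : IsOpen Ω) (hΩ_conn : IsConnected Ω) (hΩ_bdd : Bornology.IsBounded Ω)
    (hΩ_C2 : HasC2Boundary Ω)
    (β : ℝ) (hβ : β ≠ 0) (hβ_steklov : ∀ μ : ℝ, IsSteklovEigenvalue Ω μ → β ≠ -μ)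
    (u : EuclideanSpace ℝ (Fin N) → ℝ) (hu : IsRobinTorsionSolution Ω β u)
    (hu_curv : ∀ p ∈ frontier Ω, normalDerivative Ω u p * meanCurvature Ω p = 1)
    (hκ : 0 < minCurvature Ω + 2 * β) :
    ∃ z : EuclideanSpace ℝ (Fin N), ∃ R : ℝ, 0 < R ∧ Ω = Metric.ball z R ∧
      ∃ φ : ℝ → ℝ, ∀ x ∈ closure Ω, u x = φ ‖x - z‖ := by
  have : Nonempty (Fin N) := ⟨⟨0, by omega⟩⟩
  obtain ⟨z, c, hgrad, huz⟩ :=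
    exists_eq_paraboloid hN hΩ_open hΩ_conn hΩ_bdd hΩ_C2 hu hu_curv hκ
  obtain ⟨R, hR⟩ := exists_frontier_subset_sphere hN hΩ_open hΩ_conn hΩ_bdd hΩ_C2 hu hβ hu_curv hκ
    hgrad huz
  obtain ⟨hR0, hball⟩ := eq_ball_of_frontier_subset_sphere hΩ_open hΩ_conn.nonempty hΩ_bdd hR
  exact ⟨z, R, hR0, hball, fun t => t ^ 2 / 2 + c, huz⟩
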